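/- \textbf{Setting.} A (Landau--Ginzburg) skeleton on $n$ nodes is a directed graph without loops in which every node has at most one outgoing edge; a node with no outgoing edge is a root, and a node $i$ with an edge $i\to\pi(i)$ is a pointer. It is connected if its underlying undirected graph is. Exponents on a skeleton are integers $\mathbf M=(m_1,\dots,m_n)$ with $m_i\ge 3$ if $i$ is a root and $m_i\ge 2$ if $i$ is a pointer. They determine rational charges $q_1,\dots,q_n$ by $m_iq_i=1$ for a root and $m_iq_i+q_{\pi(i)}=1$ for a pointer. The central charge is $c=3\sum_i(1-2q_i)$; for $n=4$, $c<6$ means $\sum_i q_i>1$. The exponents are feasible (without pointing links) if for any two distinct pointers $i,j$ with $\pi(i)=\pi(j)$ there are integers $a,b\ge 0$ with $aq_i+bq_j=1$. They are reducible if there is more than one root, or if there is at most one root and some pointer $i$ has $kq_i=1$ for a positive integer $k$. For a skeleton $S$ let $E(S)$ be the set of its irreducible feasible exponents with $c<6$. Let $S_{4,1},\dots,S_{4,9}$ be the skeletons with nodes $1,2,3,4$ and edges $S_{4,1}: 4\to1\to2\to3$; $S_{4,2}: 1\to2,\ 4\to3\to2$; $S_{4,3}: 1\to2,\ 4\to2,\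 2\to3$; $S_{4,4}: 1\to2,\ 3\to2,\ 4\to2$; $S_{4,5}: 1\to2\to3\to4\to1$; $S_{4,6}: 4\to3\to2\to1\to2$; $S_{4,7}: 1\to2\to3\to1,\ 4\to1$; $S_{4,8}: 3\to2,\ 4\to1,\ 1\to2,\ 2\to1$; $S_{4,9}: 3\to2,\ 4\to2,\ 1\to2,\ 2\to1$. \textbf{Theorem.} These nine skeletons are connected, and every connected skeleton on four nodes is isomorphic to exactly one of them. Moreover: (0) $E(S_{4,3})=E(S_{4,4})=E(S_{4,6})=E(S_{4,8})=E(S_{4,9})=\emptyset$. (1) On $S_{4,1}$ consider the following families of exponents with their charges, where $k,l$ are non-negative integers: $(k,3,3,2)$: $\left(\frac{7}{9k},\frac29,\frac13,\frac{9k-7}{18k}\right)$; $(2,2,k,3)$: $\left(\frac{k+1}{4k},\frac{k-1}{2k},\frac1k,\frac{3k-1}{12k}\right)$; $(2,3,k,2)$: $\left(\frac{2k+1}{6k},\frac{k-1}{3k},\frac1k,\frac{4k-1}{12k}\right)$; $(2,k,3,2)$: $\left(\frac{3k-2}{6k},\frac{2}{3k},\frac13,\frac{3k+2}{12k}\right)$;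 $(2,k,3,3)$: $\left(\frac{3k-2}{6k},\frac{2}{3k},\frac13,\frac{3k+2}{18k}\right)$; $(3,k,3,2)$: $\left(\frac{3k-2}{9k},\frac{2}{3k},\frac13,\frac{3k+1}{9k}\right)$; $(2,k,4,2)$: $\left(\frac{4k-3}{8k},\frac{3}{4k},\frac14,\frac{4k+3}{16k}\right)$; $(k,2,l,2)$: $\left(\frac{l+1}{2kl},\frac{l-1}{2l},\frac1l,\frac{2kl-l-1}{4kl}\right)$. Whenever the exponents are admissible on $S_{4,1}$, the charges are as listed and $c<6$. In each one-parameter family there are members in $E(S_{4,1})$ with arbitrarily large $k$, and in the two-parameter family for every $N$ there is a member in $E(S_{4,1})$ with $k,l\ge N$. Exactly $108$ elements of $E(S_{4,1})$ belong to none of the eight families, and the largest exponent occurring in them is $13$. (2) On $S_{4,2}$, for all integers $k,l\ge0$ for which the exponents $\mathbf M=(2,4k+3,(2l+1)(2k+1),2)$ are admissible, the charges are $$\left(\tfrac12\tfrac{4k+2}{4k+3},\ \tfrac1{4k+3},\ \tfrac{4k+2}{(2l+1)(2k+1)(4k+3)},\ \tfrac12\tfrac{(4k+3)(2l+1)(2k+1)-4k-2}{(2l+1)(2k+1)(4k+3)}\right)$$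 and $c<6$. The set $E(S_{4,2})$ consists exactly of these exponents with $k\ge1$, $l\ge0$, and the five exponents $(2,7,3,3)$, $(2,7,3,4)$, $(3,7,2,2)$, $(3,7,2,3)$, $(3,7,4,2)$. (3) On $S_{4,5}$ consider, for non-negative integers $k,l$, the families $(3,2,2,k)$: $\left(\frac{3k-1}{12k-1},\frac{3k+2}{12k-1},\frac{6k-5}{12k-1},\frac{9}{12k-1}\right)$; $(2,2,3,k)$: $\left(\frac{4k-1}{12k-1},\frac{4k+1}{12k-1},\frac{4k-3}{12k-1},\frac{8}{12k-1}\right)$; $(2,k,2,l)$: $\left(\frac{2kl-l-1}{4kl-1},\frac{2l+1}{4kl-1},\frac{2kl-k-1}{4kl-1},\frac{2k+1}{4kl-1}\right)$. Whenever the exponents are admissible, the charges are as listed and $c<6$. In each one-parameter family there are members in $E(S_{4,5})$ with arbitrarily large $k$, and in the two-parameter family for every $N$ there is a member in $E(S_{4,5})$ with $k,l\ge N$. Only finitely many elements of $E(S_{4,5})$ are not cyclic rotations of members of the three families; up to cyclic rotation there are exactly $22$ of them, and the largest exponent occurring in them is $8$. (4) On $S_{4,7}$, for every integer $k\ge 0$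 for which the exponents $\mathbf M=(2,2,3k+1,3)$ are admissible, the charges are $\left(\frac{3k+2}{12k+5},\frac{6k+1}{12k+5},\frac{3}{12k+5},\frac{3k+1}{12k+5}\right)$ and $c<6$. The set $E(S_{4,7})$ consists exactly of these exponents with $k\ge1$ and the exponent $(3,2,2,5)$. -/

import Mathlib

namespace LG

/-- A Landau-Ginzburg skeleton on `n` nodes. Every node has at most one outgoing arrow and no arrow
to itself: `target i = none` if `X i` is a root, `target i = some j` if `X i` points at `X j`. -/
structure Skeleton (n : ℕ) where
  target : Fin n → Option (Fin n)
  no_loop : ∀ i, target i ≠ some i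

namespace Skeleton

variable {n : ℕ}

/-- The skeleton is connected as an undirected graph. -/
def Connected (S : Skeleton n) : Prop :=
  (SimpleGraph.fromRel fun i j : Fin n => S.target i = some j).Connected

/-- Two skeletons agree up to a relabelling of the nodes. -/
def Iso (S T : Skeleton n) : Prop :=
  ∃ σ : Equiv.Perm (Fin n), ∀ i, T.target (σ i) = (S.target i).map σ

/-- Admissible exponents: at least `3` for a root and at least `2` for a pointer. -/
def IsExponents (S : Skeleton n) (m : Fin n → ℕ) : Prop :=
  ∀ i, (S.target i = none → 3 ≤ m i) ∧ (S.target i ≠ none → 2 ≤ m i)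

/-- The charge of the variable that `X i` points at (`0` for a root). -/
def targetCharge (S : Skeleton n) (q : Fin n → ℚ) (i : Fin n) : ℚ :=
  match S.target i with
  | none => 0
  | some j => q j

/-- `q` is the charge vector of the skeleton potential with exponents `m`: each of its monomials,
`X i ^ m i` for a root and `X i ^ m i * X j` for a pointer at `X j`, has charge `1`. -/
def IsCharges (S : Skeleton n) (m : Fin n → ℕ) (q : Fin n → ℚ) : Prop :=
  ∀ i, (m i : ℚ) * q i + S.targetCharge q i = 1

/-- Admissible exponents determine the charges. -/
theorem existsUnique_isCharges (S : Skeleton n) (m : Fin n → ℕ) (hm : S.IsExponents m) :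
    ∃! q, S.IsCharges m q := by
  classical
  let A : Matrix (Fin n) (Fin n) ℚ := fun i j =>
    if i = j then (m i : ℚ) else if S.target i = some j then 1 else 0
  have hA : ∀ q : Fin n → ℚ, S.IsCharges m q ↔ A.mulVec q = 1 := by
    intro q
    have key : ∀ i, A.mulVec q i = (m i : ℚ) * q i + S.targetCharge q i := by
      intro i
      have h1 : ∀ j, A i j * q j =
          (if i = j then (m i : ℚ) * q i else 0) + (if S.target i = some j then q j else 0) := by
        intro j
        by_cases h : i = j
        · subst h; simp [A, S.no_loop i]
        · simp [A, h]
      simp only [Matrix.mulVec, dotProduct, h1, Finset.sum_add_distrib, targetCharge]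
      cases hT : S.target i <;> simp
    constructor
    · intro h; ext i; rw [key i]; exact h i
    · intro h i; rw [← key i, h]; rfl
  have hdet : A.det ≠ 0 := by
    apply det_ne_zero_of_sum_row_lt_diag
    intro k
    have hk : (2 : ℝ) ≤ m k := by
      have := hm k
      by_cases h : S.target k = none
      · have := this.1 h; exact_mod_cast (by omega : 2 ≤ m k)
      · exact_mod_cast this.2 h
    have h2 : ∑ j ∈ Finset.univ.erase k, ‖A k j‖ ≤
        ∑ j : Fin n, if S.target k = some j then (1 : ℝ) else 0 := by
      refine (Finset.sum_le_sum (f := fun j => ‖A k j‖)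
        (g := fun j => if S.target k = some j then (1 : ℝ) else 0) ?_).trans
        (Finset.sum_le_sum_of_subset_of_nonneg (Finset.subset_univ _) ?_)
      · intro j hj
        have : k ≠ j := (Finset.ne_of_mem_erase hj).symm
        by_cases h : S.target k = some j <;> simp [A, this, h]
      · intro j _ _; split_ifs <;> norm_num
    have h3 : (∑ j : Fin n, if S.target k = some j then (1 : ℝ) else 0) ≤ 1 := by
      cases hT : S.target k <;> simp
    have h4 : ‖A k k‖ = m k := by
      simp only [A, if_true]
      rw [← Rat.norm_cast_real]; simp
    rw [h4]; linarith
  have hu : IsUnit A.det := isUnit_iff_ne_zero.mpr hdet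
  refine ⟨A⁻¹.mulVec 1, (hA _).2 (by simp [Matrix.mulVec_mulVec, Matrix.mul_nonsing_inv _ hu]), ?_⟩
  intro q hq
  have := (hA q).1 hq
  rw [← this, Matrix.mulVec_mulVec, Matrix.nonsing_inv_mul _ hu, Matrix.one_mulVec]

/-- Feasibility without pointing links: any two pointers `X i`, `X j` with a common target are
joined by a link `X i ^ a * X j ^ b`, a monomial of charge `1` in these two variables only. -/
def Feasible (S : Skeleton n) (q : Fin n → ℚ) : Prop :=
  ∀ i j v, i ≠ j → S.target i = some v → S.target j = some v →
    ∃ a b : ℕ, (a : ℚ) * q i + (b : ℚ) * q j = 1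

/-- The number of roots. -/
def numRoots (S : Skeleton n) : ℕ :=
  (Finset.univ.filter fun i => S.target i = none).card

/-- Reducibility: more than one root, or at most one root while some pointer variable can appear
as a root, that is, some pure power `X i ^ k` of it has charge `1`. -/
def Reducible (S : Skeleton n) (q : Fin n → ℚ) : Prop :=
  1 < S.numRoots ∨
    (S.numRoots ≤ 1 ∧ ∃ i, S.target i ≠ none ∧ ∃ k : ℕ, (k : ℚ) * q i = 1)

end Skeleton

/-- The central charge `c = 3 ∑ (1 - 2 q i)`. -/
def centralCharge {n : ℕ} (q : Fin n → ℚ) : ℚ := 3 * ∑ i, (1 - 2 * q i)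

/-- The exponents on `S` that are irreducible, feasible (without pointing links) and have
`c < 6`. -/
def Skeleton.irreducibleExponents {n : ℕ} (S : Skeleton n) : Set (Fin n → ℕ) :=
  {m | S.IsExponents m ∧ ∃ q, S.IsCharges m q ∧ S.Feasible q ∧ ¬ S.Reducible q ∧
    centralCharge q < 6}

/-! The connected skeletons on four nodes. The variable `X_i` with exponent `m_i`, `i = 1, …, 4`,
is the element `i - 1` of `Fin 4`. -/

def S41 : Skeleton 4 := ⟨![some 1, some 2, none, some 0], by decide⟩
def S42 : Skeleton 4 := ⟨![some 1, none, some 1, some 2], by decide⟩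
def S43 : Skeleton 4 := ⟨![some 1, some 2, none, some 1], by decide⟩
def S44 : Skeleton 4 := ⟨![some 1, none, some 1, some 1], by decide⟩
def S45 : Skeleton 4 := ⟨![some 1, some 2, some 3, some 0], by decide⟩
def S46 : Skeleton 4 := ⟨![some 1, some 0, some 1, some 2], by decide⟩
def S47 : Skeleton 4 := ⟨![some 1, some 2, some 0, some 0], by decide⟩
def S48 : Skeleton 4 := ⟨![some 1, some 0, some 1, some 0], by decide⟩
def S49 : Skeleton 4 := ⟨![some 1, some 0, some 1, some 1], by decide⟩

def skeletons4 : Fin 9 → Skeleton 4 := ![S41, S42, S43, S44, S45, S46, S47, S48, S49]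

/-! The infinite families: exponents together with charges. -/

/-- The seven one-parameter families on `S41`. -/
def family41 : Fin 7 → ℕ → (Fin 4 → ℕ) × (Fin 4 → ℚ) := ![
  fun k => (![k, 3, 3, 2], ![7 / (9 * k), 2 / 9, 1 / 3, (9 * k - 7) / (18 * k)]),
  fun k => (![2, 2, k, 3],
    ![(k + 1) / (4 * k), (k - 1) / (2 * k), 1 / k, (3 * k - 1) / (12 * k)]),
  fun k => (![2, 3, k, 2],
    ![(2 * k + 1) / (6 * k), (k - 1) / (3 * k), 1 / k, (4 * k - 1) / (12 * k)]),
  fun k => (![2, k, 3, 2],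
    ![(3 * k - 2) / (6 * k), 2 / (3 * k), 1 / 3, (3 * k + 2) / (12 * k)]),
  fun k => (![2, k, 3, 3],
    ![(3 * k - 2) / (6 * k), 2 / (3 * k), 1 / 3, (3 * k + 2) / (18 * k)]),
  fun k => (![3, k, 3, 2],
    ![(3 * k - 2) / (9 * k), 2 / (3 * k), 1 / 3, (3 * k + 1) / (9 * k)]),
  fun k => (![2, k, 4, 2],
    ![(4 * k - 3) / (8 * k), 3 / (4 * k), 1 / 4, (4 * k + 3) / (16 * k)])]

/-- The two-parameter family on `S41`. -/
def family41' (k l : ℕ) : (Fin 4 → ℕ) × (Fin 4 → ℚ) :=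
  (![k, 2, l, 2],
    ![(l + 1) / (2 * k * l), (l - 1) / (2 * l), 1 / l, (2 * k * l - l - 1) / (4 * k * l)])

/-- The two-parameter family on `S42`. -/
def family42 (k l : ℕ) : (Fin 4 → ℕ) × (Fin 4 → ℚ) :=
  (![2, 4 * k + 3, (2 * l + 1) * (2 * k + 1), 2],
    ![1 / 2 * ((4 * k + 2) / (4 * k + 3)), 1 / (4 * k + 3),
      (4 * k + 2) / ((2 * l + 1) * (2 * k + 1) * (4 * k + 3)),
      1 / 2 * (((4 * k + 3) * (2 * l + 1) * (2 * k + 1) - 4 * k - 2) /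
        ((2 * l + 1) * (2 * k + 1) * (4 * k + 3)))])

/-- The two one-parameter families on `S45`. -/
def family45 : Fin 2 → ℕ → (Fin 4 → ℕ) × (Fin 4 → ℚ) := ![
  fun k => (![3, 2, 2, k],
    ![(3 * k - 1) / (12 * k - 1), (3 * k + 2) / (12 * k - 1), (6 * k - 5) / (12 * k - 1),
      9 / (12 * k - 1)]),
  fun k => (![2, 2, 3, k],
    ![(4 * k - 1) / (12 * k - 1), (4 * k + 1) / (12 * k - 1), (4 * k - 3) / (12 * k - 1),
      8 / (12 * k - 1)])]

/-- The two-parameter family on `S45`. -/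
def family45' (k l : ℕ) : (Fin 4 → ℕ) × (Fin 4 → ℚ) :=
  (![2, k, 2, l],
    ![(2 * k * l - l - 1) / (4 * k * l - 1), (2 * l + 1) / (4 * k * l - 1),
      (2 * k * l - k - 1) / (4 * k * l - 1), (2 * k + 1) / (4 * k * l - 1)])

/-- The one-parameter family on `S47`. -/
def family47 (k : ℕ) : (Fin 4 → ℕ) × (Fin 4 → ℚ) :=
  (![2, 2, 3 * k + 1, 3],
    ![(3 * k + 2) / (12 * k + 5), (6 * k + 1) / (12 * k + 5), 3 / (12 * k + 5),
      (3 * k + 1) / (12 * k + 5)])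

/-- The member `f = (m, q)` of a family is realized on `S`: if `m` is admissible on `S`, then `q`
is its charge vector and `c < 6`. -/
def Realized (S : Skeleton 4) (f : (Fin 4 → ℕ) × (Fin 4 → ℚ)) : Prop :=
  S.IsExponents f.1 → S.IsCharges f.1 f.2 ∧ centralCharge f.2 < 6

/-- The cyclic rotations of a 4-tuple of exponents. -/
def cyclicClass (m : Fin 4 → ℕ) : Set (Fin 4 → ℕ) := {m' | ∃ r : Fin 4, ∀ i, m' i = m (i + r)}

/-- The irreducible exponents on `S41` outside the families. -/
def sporadic41 : Set (Fin 4 → ℕ) :=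
  {m | m ∈ S41.irreducibleExponents ∧ (∀ a k, m ≠ (family41 a k).1) ∧
    ∀ k l, m ≠ (family41' k l).1}

/-- The irreducible exponents on `S45` outside the families and their cyclic rotations. -/
def sporadic45 : Set (Fin 4 → ℕ) :=
  {m | m ∈ S45.irreducibleExponents ∧ (∀ a k, m ∉ cyclicClass (family45 a k).1) ∧
    ∀ k l, m ∉ cyclicClass (family45' k l).1}

end LG

/-! The classification of skeletons is a finite check: a skeleton on four nodes either has no arrows
across some bipartition of the nodes, hence is disconnected, or is carried to one of the nine by a
relabelling.

For the exponents, write the charges as `N i / D` over a common denominator. Reducibility of a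
single-root or rootless skeleton is then `N i ∣ D` at a pointer, a link is a solution of `x * N i +
y * N j = D` in naturals, and `c < 6` is `D < ∑ N i`. Cleared of denominators, `c < 6` says that a
polynomial of degree one in each exponent is negative; since that polynomial is not positive where
one exponent vanishes, the region is closed downwards (`downClosed_of_affine`). So truncating every
exponent at a bound `B` keeps a tuple in the region (`DownClosed.truncate`), and only a finite box
has to be searched, where the value `B` stands for all values at least `B`.

The search on each skeleton (`remains41`, `remains42`, ...) shows that every tuple in the box
satisfies a clause of a list chosen so that it also speaks about the untruncated tuple: it uses only
exponents below `B`, or inequalities that survive enlarging an exponent. Such a clause contradicts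
irreducibility or feasibility, or places the tuple in a family, in a strip to be treated by hand, or
on an explicit list. The strips left unbounded by `c < 6` are settled by arithmetic of the link
equation; on `S42` and `S47` this produces the families (`exists_family42`).

On `S44` and `S49` three pointers share a target, and `c < 6` becomes `1/a + 1/c + 1/d > 1` with
distinct exponents, so these are at most `5` and no truncation is needed. -/

namespace LG

/-! ### Connectedness and the classification of skeletons -/

namespace Skeleton

/-- A connected skeleton admits no non-constant labelling that is preserved by all arrows. -/
theorem connected_iff_forall_labelling {n : ℕ} (S : Skeleton (n + 1)) :
    S.Connected ↔ ∀ f : Fin (n + 1) → Bool,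
      (∀ i j, S.target i = some j → f i = f j) → ∀ i, f i = f 0 := by
  classical
  constructor
  · intro h f hf i
    obtain ⟨w⟩ := h.preconnected i 0
    generalize (0 : Fin (n + 1)) = z at w ⊢
    induction w with
    | nil => rfl
    | cons hadj _ ih =>
      rw [← ih]
      rcases ((SimpleGraph.fromRel_adj _ _ _).1 hadj).2 with h | h
      · exact hf _ _ h
      · exact (hf _ _ h).symm
  · intro h
    have key : ∀ i, (SimpleGraph.fromRel fun i j => S.target i = some j).Reachable i 0 := by
      intro i
      -- The labelling is the indicator of the component of node `0`.
      have := h (fun i => decide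
        ((SimpleGraph.fromRel fun i j => S.target i = some j).Reachable i 0)) ?_ i
      · simpa using this
      · intro i j hij
        have hne : i ≠ j := fun h => S.no_loop i (by rw [hij, h])
        have hadj : (SimpleGraph.fromRel fun i j => S.target i = some j).Adj i j :=
          (SimpleGraph.fromRel_adj _ _ _).2 ⟨hne, Or.inl hij⟩
        simp only [decide_eq_decide]
        exact ⟨fun h => hadj.symm.reachable.trans h, fun h => hadj.reachable.trans h⟩
    exact ⟨fun i j => (key i).trans (key j).symm⟩

theorem Iso.symm {n : ℕ} {S T : Skeleton n} (h : S.Iso T) : T.Iso S := by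
  obtain ⟨σ, hσ⟩ := h
  refine ⟨σ.symm, fun i => ?_⟩
  have := hσ (σ.symm i)
  rw [Equiv.apply_symm_apply] at this
  rw [this, Option.map_map]
  simp

theorem Iso.trans {n : ℕ} {S T U : Skeleton n} (h : S.Iso T) (h' : T.Iso U) : S.Iso U := by
  obtain ⟨σ, hσ⟩ := h
  obtain ⟨τ, hτ⟩ := h'
  refine ⟨σ.trans τ, fun i => ?_⟩
  rw [Equiv.trans_apply, hτ, hσ, Option.map_map]
  rfl

end Skeleton

theorem connected_skeletons4 (α : Fin 9) : (skeletons4 α).Connected := by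
  rw [Skeleton.connected_iff_forall_labelling]
  revert α
  decide +kernel

/-- The relabellings of four nodes, as lists of values. -/
def relabellings4 : List (Fin 4 × Fin 4 × Fin 4 × Fin 4) :=
  (List.finRange 4).flatMap fun a => (List.finRange 4).flatMap fun b =>
    (List.finRange 4).flatMap fun c => (List.finRange 4).filterMap fun d =>
      if a ≠ b ∧ a ≠ c ∧ a ≠ d ∧ b ≠ c ∧ b ≠ d ∧ c ≠ d then some (a, b, c, d) else none

/-- Whether the relabelling `p` carries the arrows `t` to the arrows `u`. -/
def carries4 (t u : Fin 4 → Option (Fin 4)) (p : Fin 4 × Fin 4 × Fin 4 × Fin 4) : Bool :=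
  u p.1 == (t 0).map ![p.1, p.2.1, p.2.2.1, p.2.2.2] &&
  u p.2.1 == (t 1).map ![p.1, p.2.1, p.2.2.1, p.2.2.2] &&
  u p.2.2.1 == (t 2).map ![p.1, p.2.1, p.2.2.1, p.2.2.2] &&
  u p.2.2.2 == (t 3).map ![p.1, p.2.1, p.2.2.1, p.2.2.2]

/-- Isomorphism becomes a search through an explicit list of 24 relabellings, which the kernel can
evaluate. -/
theorem Skeleton.iso_iff_carries4 (S T : Skeleton 4) :
    S.Iso T ↔ relabellings4.any (carries4 S.target T.target) = true := by
  rw [List.any_eq_true]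
  constructor
  · rintro ⟨σ, hσ⟩
    refine ⟨(σ 0, σ 1, σ 2, σ 3), ?_, ?_⟩
    · have : ∀ p : Fin 4 × Fin 4 × Fin 4 × Fin 4, p.1 ≠ p.2.1 → p.1 ≠ p.2.2.1 →
          p.1 ≠ p.2.2.2 → p.2.1 ≠ p.2.2.1 → p.2.1 ≠ p.2.2.2 → p.2.2.1 ≠ p.2.2.2 →
          p ∈ relabellings4 := by
        decide +kernel
      apply this <;> simp
    · have hv : ![σ 0, σ 1, σ 2, σ 3] = σ := by ext i; fin_cases i <;> rfl
      simp [carries4, hv, hσ]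
  · rintro ⟨p, hp, hc⟩
    have hinj : ∀ p ∈ relabellings4,
        Function.Injective ![p.1, p.2.1, p.2.2.1, p.2.2.2] := by
      decide +kernel
    refine ⟨Equiv.ofBijective _ (Finite.injective_iff_bijective.1 (hinj p hp)), ?_⟩
    simp only [carries4, Bool.and_eq_true, beq_iff_eq] at hc
    obtain ⟨⟨⟨h0, h1⟩, h2⟩, h3⟩ := hc
    intro i
    fin_cases i
    · exact h0
    · exact h1
    · exact h2
    · exact h3

/-- The seven labellings are the bipartitions of four nodes into non-empty parts, up to swapping the
parts, so they detect every disconnected skeleton. -/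
theorem exists_iso_or_exists_labelling : ∀ a b c d : Option (Fin 4),
    a = some 0 ∨ b = some 1 ∨ c = some 2 ∨ d = some 3 ∨
    (∃ α, relabellings4.any (carries4 ![a, b, c, d] (skeletons4 α).target) = true) ∨
    ∃ f ∈ [![true, false, false, false], ![false, true, false, false],
        ![false, false, true, false], ![false, false, false, true], ![true, true, false, false],
        ![true, false, true, false], ![true, false, false, true]],
      (∀ i j, ![a, b, c, d] i = some j → f i = f j) := by
  decide +kernel

theorem not_carries4_skeletons4 : ∀ α β : Fin 9, α ≠ β →
    relabellings4.any (carries4 (skeletons4 α).target (skeletons4 β).target) = false := by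
  decide +kernel

theorem existsUnique_iso_skeletons4 (S : Skeleton 4) (hS : S.Connected) :
    ∃! α : Fin 9, S.Iso (skeletons4 α) := by
  have ht : ![S.target 0, S.target 1, S.target 2, S.target 3] = S.target := by
    ext i : 1; fin_cases i <;> rfl
  rw [Skeleton.connected_iff_forall_labelling] at hS
  have hex : ∃ α, S.Iso (skeletons4 α) := by
    rcases exists_iso_or_exists_labelling (S.target 0) (S.target 1) (S.target 2) (S.target 3) with
      h | h | h | h | ⟨α, h⟩ | ⟨f, hf, h⟩
    · exact absurd h (S.no_loop 0)
    · exact absurd h (S.no_loop 1)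
    · exact absurd h (S.no_loop 2)
    · exact absurd h (S.no_loop 3)
    · exact ⟨α, (S.iso_iff_carries4 _).2 (by rwa [ht] at h)⟩
    · rw [ht] at h
      have hc := hS f h
      have hne : ∀ f ∈ [![true, false, false, false], ![false, true, false, false],
          ![false, false, true, false], ![false, false, false, true], ![true, true, false, false],
          ![true, false, true, false], ![true, false, false, true]], ¬ ∀ i, f i = f 0 := by
        decide
      exact absurd hc (hne f hf)
  obtain ⟨α, hα⟩ := hex
  refine ⟨α, hα, fun β hβ => ?_⟩
  by_contra hne
  have h := hβ.symm.trans hα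
  rw [Skeleton.iso_iff_carries4, not_carries4_skeletons4 β α hne] at h
  exact Bool.false_ne_true h

/-! ### Irreducibility, feasibility and `c < 6` over the integers -/

namespace Skeleton

/-- By uniqueness the charges are `N i / D`, and multiplying each condition by `D` makes it one on
natural numbers. Links are symmetric, so `i < j` is enough. -/
theorem mem_irreducibleExponents_iff {S : Skeleton 4} {m : Fin 4 → ℕ} (hr : S.numRoots ≤ 1)
    (hm : S.IsExponents m) (N : Fin 4 → ℕ) (D : ℕ) (hD : 0 < D)
    (hq : ∀ i, m i * N i + (S.target i).elim 0 N = D) :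
    m ∈ S.irreducibleExponents ↔
      (∀ i j, i < j → S.target i = S.target j → S.target i ≠ none →
        ∃ x y : ℕ, x * N i + y * N j = D) ∧
      (∀ i, S.target i ≠ none → ¬ N i ∣ D) ∧ D < N 0 + N 1 + N 2 + N 3 := by
  have hD' : (D : ℚ) ≠ 0 := by positivity
  have hDp : (0 : ℚ) < D := by positivity
  have hc : S.IsCharges m fun i => (N i : ℚ) / D := by
    intro i
    have h : ((m i * N i + (S.target i).elim 0 N : ℕ) : ℚ) = D := by rw [hq i]
    rw [Nat.cast_add, Nat.cast_mul] at h
    unfold targetCharge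
    cases hT : S.target i <;> simp only [hT, Option.elim_none, Option.elim_some] at h ⊢
    · field_simp; simpa using h
    · field_simp; exact h
  have hlink : ∀ i j : Fin 4, ∀ x y : ℕ,
      (x : ℚ) * ((N i : ℚ) / D) + (y : ℚ) * ((N j : ℚ) / D) = 1 ↔ x * N i + y * N j = D := by
    intro i j x y
    rw [← mul_div_assoc, ← mul_div_assoc, ← add_div, div_eq_one_iff_eq hD']
    norm_cast
  have hpow : ∀ i : Fin 4, (∃ k : ℕ, (k : ℚ) * ((N i : ℚ) / D) = 1) ↔ N i ∣ D := by
    intro i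
    refine exists_congr fun k => ?_
    rw [← mul_div_assoc, div_eq_one_iff_eq hD']
    norm_cast
    rw [mul_comm, eq_comm]
  have hcc : centralCharge (fun i => (N i : ℚ) / D) < 6 ↔ D < N 0 + N 1 + N 2 + N 3 := by
    have : centralCharge (fun i => (N i : ℚ) / D) =
        3 * (4 - 2 * (((N 0 + N 1 + N 2 + N 3 : ℕ) : ℚ) / D)) := by
      simp only [centralCharge, Fin.sum_univ_four]
      push_cast
      ring
    rw [this]
    have h1 : (1 : ℚ) < ((N 0 + N 1 + N 2 + N 3 : ℕ) : ℚ) / D ↔ D < N 0 + N 1 + N 2 + N 3 := by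
      rw [lt_div_iff₀ hDp, one_mul]
      norm_cast
    rw [← h1]
    constructor <;> intro h <;> linarith
  have hfe : S.Feasible (fun i => (N i : ℚ) / D) ↔
      ∀ i j, i < j → S.target i = S.target j → S.target i ≠ none →
        ∃ x y : ℕ, x * N i + y * N j = D := by
    constructor
    · intro h i j hij hT hne
      obtain ⟨v, hv⟩ := Option.ne_none_iff_exists'.1 hne
      obtain ⟨x, y, hxy⟩ := h i j v hij.ne hv (hT ▸ hv)
      exact ⟨x, y, (hlink i j x y).1 hxy⟩
    · intro h i j v hij hi hj
      rcases lt_or_gt_of_ne hij with hlt | hlt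
      · obtain ⟨x, y, hxy⟩ := h i j hlt (hi.trans hj.symm) (by simp [hi])
        exact ⟨x, y, (hlink i j x y).2 hxy⟩
      · obtain ⟨x, y, hxy⟩ := h j i hlt (hj.trans hi.symm) (by simp [hj])
        exact ⟨y, x, (hlink i j y x).2 (by rw [← hxy, add_comm])⟩
  have hre : ¬ S.Reducible (fun i => (N i : ℚ) / D) ↔
      ∀ i, S.target i ≠ none → ¬ N i ∣ D := by
    simp only [Reducible, not_or, not_lt, hr, true_and, hpow, not_exists, not_and]
  rw [← hfe, ← hre, ← hcc]
  constructor
  · rintro ⟨-, q, hq', h1, h2, h3⟩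
    have : q = fun i => (N i : ℚ) / D := (S.existsUnique_isCharges m hm).unique hq' hc
    subst this
    exact ⟨h1, h2, h3⟩
  · rintro ⟨h1, h2, h3⟩
    exact ⟨hm, _, hc, h1, h2, h3⟩

theorem mem_irreducibleExponents_iff_and {S : Skeleton 4} {m : Fin 4 → ℕ} (hr : S.numRoots ≤ 1)
    {P : Prop} (hm : S.IsExponents m ↔ P) (N : Fin 4 → ℕ) (D : ℕ) (hD : P → 0 < D)
    (hq : P → ∀ i, m i * N i + (S.target i).elim 0 N = D) :
    m ∈ S.irreducibleExponents ↔ P ∧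
      (∀ i j, i < j → S.target i = S.target j → S.target i ≠ none →
        ∃ x y : ℕ, x * N i + y * N j = D) ∧
      (∀ i, S.target i ≠ none → ¬ N i ∣ D) ∧ D < N 0 + N 1 + N 2 + N 3 := by
  constructor
  · intro h
    have hP := hm.1 h.1
    exact ⟨hP, (mem_irreducibleExponents_iff hr h.1 N D (hD hP) (hq hP)).1 h⟩
  · rintro ⟨hP, h⟩
    exact (mem_irreducibleExponents_iff hr (hm.2 hP) N D (hD hP) (hq hP)).2 h

end Skeleton

theorem eq_vec4 (m : Fin 4 → ℕ) : m = ![m 0, m 1, m 2, m 3] := by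
  ext i; fin_cases i <;> rfl

open Skeleton

/-- The numerators come from solving the charge equations from the root upwards. On the skeletons
without root the cycle is solved first; it contributes to `D` the product of its exponents minus `1`
for even length, plus `1` for length three. -/
theorem mem_S41 (a b c d : ℕ) : ![a, b, c, d] ∈ S41.irreducibleExponents ↔
    2 ≤ a ∧ 2 ≤ b ∧ 3 ≤ c ∧ 2 ≤ d ∧
      ¬ d * ((b - 1) * c + 1) ∣ a * b * c * d ∧
      ¬ a * d * (c - 1) ∣ a * b * c * d ∧
      ¬ (a - 1) * b * c + (c - 1) ∣ a * b * c * d ∧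
      a * b * c * d <
      (d * ((b - 1) * c + 1)) + (a * d * (c - 1)) + (a * b * d) + ((a - 1) * b * c + (c - 1)) := by
  refine (mem_irreducibleExponents_iff_and (by decide)
    (P := 2 ≤ a ∧ 2 ≤ b ∧ 3 ≤ c ∧ 2 ≤ d) (by simp [IsExponents, S41, Fin.forall_fin_succ])
    ![d * ((b - 1) * c + 1), a * d * (c - 1), a * b * d, (a - 1) * b * c + (c - 1)]
    (a * b * c * d) ?_ ?_).trans (by simp [S41, Fin.forall_fin_succ, and_assoc])
  · rintro ⟨h1, h2, h3, h4⟩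
    positivity
  · rintro ⟨h1, h2, h3, h4⟩
    -- Shifting the exponents by their lower bounds removes the truncated subtractions.
    obtain ⟨w, rfl⟩ := Nat.exists_eq_add_of_le' h1
    obtain ⟨x, rfl⟩ := Nat.exists_eq_add_of_le' h2
    obtain ⟨y, rfl⟩ := Nat.exists_eq_add_of_le' h3
    obtain ⟨z, rfl⟩ := Nat.exists_eq_add_of_le' h4
    simp [S41, Fin.forall_fin_succ]
    and_intros <;> ring

theorem mem_S42 (a b c d : ℕ) : ![a, b, c, d] ∈ S42.irreducibleExponents ↔
    2 ≤ a ∧ 3 ≤ b ∧ 2 ≤ c ∧ 2 ≤ d ∧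
      (∃ x y : ℕ, x * ((b - 1) * c * d) + y * ((b - 1) * a * d) = a * b * c * d) ∧
      ¬ (b - 1) * c * d ∣ a * b * c * d ∧
      ¬ (b - 1) * a * d ∣ a * b * c * d ∧
      ¬ a * ((c - 1) * b + 1) ∣ a * b * c * d ∧
      a * b * c * d <
        ((b - 1) * c * d) + (a * c * d) + ((b - 1) * a * d) + (a * ((c - 1) * b + 1)) := by
  refine (mem_irreducibleExponents_iff_and (by decide)
    (P := 2 ≤ a ∧ 3 ≤ b ∧ 2 ≤ c ∧ 2 ≤ d) (by simp [IsExponents, S42, Fin.forall_fin_succ])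
    ![(b - 1) * c * d, a * c * d, (b - 1) * a * d, a * ((c - 1) * b + 1)]
    (a * b * c * d) ?_ ?_).trans (by simp [S42, Fin.forall_fin_succ, and_assoc])
  · rintro ⟨h1, h2, h3, h4⟩
    positivity
  · rintro ⟨h1, h2, h3, h4⟩
    obtain ⟨w, rfl⟩ := Nat.exists_eq_add_of_le' h1
    obtain ⟨x, rfl⟩ := Nat.exists_eq_add_of_le' h2
    obtain ⟨y, rfl⟩ := Nat.exists_eq_add_of_le' h3
    obtain ⟨z, rfl⟩ := Nat.exists_eq_add_of_le' h4
    simp [S42, Fin.forall_fin_succ]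
    and_intros <;> ring

theorem mem_S43 (a b c d : ℕ) : ![a, b, c, d] ∈ S43.irreducibleExponents ↔
    2 ≤ a ∧ 2 ≤ b ∧ 3 ≤ c ∧ 2 ≤ d ∧
      (∃ x y : ℕ, x * (d * ((b - 1) * c + 1)) + y * (a * ((b - 1) * c + 1)) = a * b * c * d) ∧
      ¬ d * ((b - 1) * c + 1) ∣ a * b * c * d ∧
      ¬ a * d * (c - 1) ∣ a * b * c * d ∧
      ¬ a * ((b - 1) * c + 1) ∣ a * b * c * d ∧
      a * b * c * d <
      (d * ((b - 1) * c + 1)) + (a * d * (c - 1)) + (a * b * d) + (a * ((b - 1) * c + 1)) := by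
  refine (mem_irreducibleExponents_iff_and (by decide)
    (P := 2 ≤ a ∧ 2 ≤ b ∧ 3 ≤ c ∧ 2 ≤ d) (by simp [IsExponents, S43, Fin.forall_fin_succ])
    ![d * ((b - 1) * c + 1), a * d * (c - 1), a * b * d, a * ((b - 1) * c + 1)]
    (a * b * c * d) ?_ ?_).trans (by simp [S43, Fin.forall_fin_succ, and_assoc])
  · rintro ⟨h1, h2, h3, h4⟩
    positivity
  · rintro ⟨h1, h2, h3, h4⟩
    obtain ⟨w, rfl⟩ := Nat.exists_eq_add_of_le' h1
    obtain ⟨x, rfl⟩ := Nat.exists_eq_add_of_le' h2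
    obtain ⟨y, rfl⟩ := Nat.exists_eq_add_of_le' h3
    obtain ⟨z, rfl⟩ := Nat.exists_eq_add_of_le' h4
    simp [S43, Fin.forall_fin_succ]
    and_intros <;> ring

theorem mem_S44 (a b c d : ℕ) : ![a, b, c, d] ∈ S44.irreducibleExponents ↔
    2 ≤ a ∧ 3 ≤ b ∧ 2 ≤ c ∧ 2 ≤ d ∧
      (∃ x y : ℕ, x * ((b - 1) * c * d) + y * ((b - 1) * a * d) = a * b * c * d) ∧
      (∃ x y : ℕ, x * ((b - 1) * c * d) + y * ((b - 1) * a * c) = a * b * c * d) ∧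
      (∃ x y : ℕ, x * ((b - 1) * a * d) + y * ((b - 1) * a * c) = a * b * c * d) ∧
      ¬ (b - 1) * c * d ∣ a * b * c * d ∧
      ¬ (b - 1) * a * d ∣ a * b * c * d ∧
      ¬ (b - 1) * a * c ∣ a * b * c * d ∧
      a * b * c * d <
        ((b - 1) * c * d) + (a * c * d) + ((b - 1) * a * d) + ((b - 1) * a * c) := by
  refine (mem_irreducibleExponents_iff_and (by decide)
    (P := 2 ≤ a ∧ 3 ≤ b ∧ 2 ≤ c ∧ 2 ≤ d) (by simp [IsExponents, S44, Fin.forall_fin_succ])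
    ![(b - 1) * c * d, a * c * d, (b - 1) * a * d, (b - 1) * a * c]
    (a * b * c * d) ?_ ?_).trans (by simp [S44, Fin.forall_fin_succ, and_assoc])
  · rintro ⟨h1, h2, h3, h4⟩
    positivity
  · rintro ⟨h1, h2, h3, h4⟩
    obtain ⟨w, rfl⟩ := Nat.exists_eq_add_of_le' h1
    obtain ⟨x, rfl⟩ := Nat.exists_eq_add_of_le' h2
    obtain ⟨y, rfl⟩ := Nat.exists_eq_add_of_le' h3
    obtain ⟨z, rfl⟩ := Nat.exists_eq_add_of_le' h4
    simp [S44, Fin.forall_fin_succ]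
    and_intros <;> ring

theorem mem_S45 (a b c d : ℕ) : ![a, b, c, d] ∈ S45.irreducibleExponents ↔
    2 ≤ a ∧ 2 ≤ b ∧ 2 ≤ c ∧ 2 ≤ d ∧
      ¬ (b - 1) * c * d + (d - 1) ∣ a * b * c * d - 1 ∧
      ¬ (c - 1) * d * a + (a - 1) ∣ a * b * c * d - 1 ∧
      ¬ (d - 1) * a * b + (b - 1) ∣ a * b * c * d - 1 ∧
      ¬ (a - 1) * b * c + (c - 1) ∣ a * b * c * d - 1 ∧
      a * b * c * d - 1 <
        ((b - 1) * c * d + (d - 1)) + ((c - 1) * d * a + (a - 1)) + ((d - 1) * a * b + (b - 1)) + ((a - 1) * b * c + (c - 1)) := by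
  refine (mem_irreducibleExponents_iff_and (by decide)
    (P := 2 ≤ a ∧ 2 ≤ b ∧ 2 ≤ c ∧ 2 ≤ d) (by simp [IsExponents, S45, Fin.forall_fin_succ])
    ![(b - 1) * c * d + (d - 1), (c - 1) * d * a + (a - 1), (d - 1) * a * b + (b - 1), (a - 1) * b * c + (c - 1)]
    (a * b * c * d - 1) ?_ ?_).trans (by simp [S45, Fin.forall_fin_succ, and_assoc])
  · rintro ⟨h1, h2, h3, h4⟩
    have : 2 * 2 * 2 * 2 ≤ a * b * c * d := by gcongr
    omega
  · rintro ⟨h1, h2, h3, h4⟩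
    obtain ⟨w, rfl⟩ := Nat.exists_eq_add_of_le' h1
    obtain ⟨x, rfl⟩ := Nat.exists_eq_add_of_le' h2
    obtain ⟨y, rfl⟩ := Nat.exists_eq_add_of_le' h3
    obtain ⟨z, rfl⟩ := Nat.exists_eq_add_of_le' h4
    have hD : (w + 2) * (x + 2) * (y + 2) * (z + 2) - 1 =
        (w + 2) * ((x + 1) * (y + 2) * (z + 2) + (z + 1)) +
          ((y + 1) * (z + 2) * (w + 2) + (w + 1)) :=
      Nat.sub_eq_of_eq_add (by ring)
    simp [S45, Fin.forall_fin_succ, hD]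
    and_intros <;> ring

theorem mem_S46 (a b c d : ℕ) : ![a, b, c, d] ∈ S46.irreducibleExponents ↔
    2 ≤ a ∧ 2 ≤ b ∧ 2 ≤ c ∧ 2 ≤ d ∧
      (∃ x y : ℕ, x * ((b - 1) * c * d) + y * (a * (b - 1) * d) = (a * b - 1) * c * d) ∧
      ¬ (b - 1) * c * d ∣ (a * b - 1) * c * d ∧
      ¬ (a - 1) * c * d ∣ (a * b - 1) * c * d ∧
      ¬ a * (b - 1) * d ∣ (a * b - 1) * c * d ∧
      ¬ (a * b - 1) * c - a * (b - 1) ∣ (a * b - 1) * c * d ∧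
      (a * b - 1) * c * d <
        ((b - 1) * c * d) + ((a - 1) * c * d) + (a * (b - 1) * d) + ((a * b - 1) * c - a * (b - 1)) := by
  refine (mem_irreducibleExponents_iff_and (by decide)
    (P := 2 ≤ a ∧ 2 ≤ b ∧ 2 ≤ c ∧ 2 ≤ d) (by simp [IsExponents, S46, Fin.forall_fin_succ])
    ![(b - 1) * c * d, (a - 1) * c * d, a * (b - 1) * d, (a * b - 1) * c - a * (b - 1)]
    ((a * b - 1) * c * d) ?_ ?_).trans (by simp [S46, Fin.forall_fin_succ, and_assoc])
  · rintro ⟨h1, h2, h3, h4⟩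
    have : 2 * 2 ≤ a * b := by gcongr
    have : 0 < a * b - 1 := by omega
    positivity
  · rintro ⟨h1, h2, h3, h4⟩
    obtain ⟨w, rfl⟩ := Nat.exists_eq_add_of_le' h1
    obtain ⟨x, rfl⟩ := Nat.exists_eq_add_of_le' h2
    obtain ⟨y, rfl⟩ := Nat.exists_eq_add_of_le' h3
    obtain ⟨z, rfl⟩ := Nat.exists_eq_add_of_le' h4
    have hD : (w + 2) * (x + 2) - 1 = (w + 2) * (x + 1) + (w + 1) :=
      Nat.sub_eq_of_eq_add (by ring)
    have hN : ((w + 2) * (x + 1) + (w + 1)) * (y + 2) - (w + 2) * (x + 1) =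
        (w + 2) * (x + 1) * (y + 1) + (w + 1) * (y + 2) :=
      Nat.sub_eq_of_eq_add (by ring)
    simp [S46, Fin.forall_fin_succ, hD, hN]
    and_intros <;> ring

theorem mem_S47 (a b c d : ℕ) : ![a, b, c, d] ∈ S47.irreducibleExponents ↔
    2 ≤ a ∧ 2 ≤ b ∧ 2 ≤ c ∧ 2 ≤ d ∧
      (∃ x y : ℕ, x * (((a - 1) * b + 1) * d) + y * (((a - 1) * b + 1) * c) = (a * b * c + 1) * d) ∧
      ¬ ((b - 1) * c + 1) * d ∣ (a * b * c + 1) * d ∧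
      ¬ ((c - 1) * a + 1) * d ∣ (a * b * c + 1) * d ∧
      ¬ ((a - 1) * b + 1) * d ∣ (a * b * c + 1) * d ∧
      ¬ ((a - 1) * b + 1) * c ∣ (a * b * c + 1) * d ∧
      (a * b * c + 1) * d <
      (((b - 1) * c + 1) * d) + (((c - 1) * a + 1) * d) + (((a - 1) * b + 1) * d) + (((a - 1) * b + 1) * c) := by
  refine (mem_irreducibleExponents_iff_and (by decide)
    (P := 2 ≤ a ∧ 2 ≤ b ∧ 2 ≤ c ∧ 2 ≤ d) (by simp [IsExponents, S47, Fin.forall_fin_succ])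
    ![((b - 1) * c + 1) * d, ((c - 1) * a + 1) * d, ((a - 1) * b + 1) * d, ((a - 1) * b + 1) * c]
    ((a * b * c + 1) * d) ?_ ?_).trans (by simp [S47, Fin.forall_fin_succ, and_assoc])
  · rintro ⟨h1, h2, h3, h4⟩
    positivity
  · rintro ⟨h1, h2, h3, h4⟩
    obtain ⟨w, rfl⟩ := Nat.exists_eq_add_of_le' h1
    obtain ⟨x, rfl⟩ := Nat.exists_eq_add_of_le' h2
    obtain ⟨y, rfl⟩ := Nat.exists_eq_add_of_le' h3
    obtain ⟨z, rfl⟩ := Nat.exists_eq_add_of_le' h4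
    simp [S47, Fin.forall_fin_succ]
    and_intros <;> ring

theorem mem_S48 (a b c d : ℕ) : ![a, b, c, d] ∈ S48.irreducibleExponents ↔
    2 ≤ a ∧ 2 ≤ b ∧ 2 ≤ c ∧ 2 ≤ d ∧
      (∃ x y : ℕ, x * ((b - 1) * c * d) + y * (a * (b - 1) * d) = (a * b - 1) * c * d) ∧
      (∃ x y : ℕ, x * ((a - 1) * c * d) + y * (b * (a - 1) * c) = (a * b - 1) * c * d) ∧
      ¬ (b - 1) * c * d ∣ (a * b - 1) * c * d ∧
      ¬ (a - 1) * c * d ∣ (a * b - 1) * c * d ∧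
      ¬ a * (b - 1) * d ∣ (a * b - 1) * c * d ∧
      ¬ b * (a - 1) * c ∣ (a * b - 1) * c * d ∧
      (a * b - 1) * c * d <
        ((b - 1) * c * d) + ((a - 1) * c * d) + (a * (b - 1) * d) + (b * (a - 1) * c) := by
  refine (mem_irreducibleExponents_iff_and (by decide)
    (P := 2 ≤ a ∧ 2 ≤ b ∧ 2 ≤ c ∧ 2 ≤ d) (by simp [IsExponents, S48, Fin.forall_fin_succ])
    ![(b - 1) * c * d, (a - 1) * c * d, a * (b - 1) * d, b * (a - 1) * c]
    ((a * b - 1) * c * d) ?_ ?_).trans (by simp [S48, Fin.forall_fin_succ, and_assoc])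
  · rintro ⟨h1, h2, h3, h4⟩
    have : 2 * 2 ≤ a * b := by gcongr
    have : 0 < a * b - 1 := by omega
    positivity
  · rintro ⟨h1, h2, h3, h4⟩
    obtain ⟨w, rfl⟩ := Nat.exists_eq_add_of_le' h1
    obtain ⟨x, rfl⟩ := Nat.exists_eq_add_of_le' h2
    obtain ⟨y, rfl⟩ := Nat.exists_eq_add_of_le' h3
    obtain ⟨z, rfl⟩ := Nat.exists_eq_add_of_le' h4
    have hD : (w + 2) * (x + 2) - 1 = (w + 2) * (x + 1) + (w + 1) :=
      Nat.sub_eq_of_eq_add (by ring)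
    simp [S48, Fin.forall_fin_succ, hD]
    and_intros <;> ring

theorem mem_S49 (a b c d : ℕ) : ![a, b, c, d] ∈ S49.irreducibleExponents ↔
    2 ≤ a ∧ 2 ≤ b ∧ 2 ≤ c ∧ 2 ≤ d ∧
      (∃ x y : ℕ, x * ((b - 1) * c * d) + y * (a * (b - 1) * d) = (a * b - 1) * c * d) ∧
      (∃ x y : ℕ, x * ((b - 1) * c * d) + y * (a * (b - 1) * c) = (a * b - 1) * c * d) ∧
      (∃ x y : ℕ, x * (a * (b - 1) * d) + y * (a * (b - 1) * c) = (a * b - 1) * c * d) ∧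
      ¬ (b - 1) * c * d ∣ (a * b - 1) * c * d ∧
      ¬ (a - 1) * c * d ∣ (a * b - 1) * c * d ∧
      ¬ a * (b - 1) * d ∣ (a * b - 1) * c * d ∧
      ¬ a * (b - 1) * c ∣ (a * b - 1) * c * d ∧
      (a * b - 1) * c * d <
        ((b - 1) * c * d) + ((a - 1) * c * d) + (a * (b - 1) * d) + (a * (b - 1) * c) := by
  refine (mem_irreducibleExponents_iff_and (by decide)
    (P := 2 ≤ a ∧ 2 ≤ b ∧ 2 ≤ c ∧ 2 ≤ d) (by simp [IsExponents, S49, Fin.forall_fin_succ])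
    ![(b - 1) * c * d, (a - 1) * c * d, a * (b - 1) * d, a * (b - 1) * c]
    ((a * b - 1) * c * d) ?_ ?_).trans (by simp [S49, Fin.forall_fin_succ, and_assoc])
  · rintro ⟨h1, h2, h3, h4⟩
    have : 2 * 2 ≤ a * b := by gcongr
    have : 0 < a * b - 1 := by omega
    positivity
  · rintro ⟨h1, h2, h3, h4⟩
    obtain ⟨w, rfl⟩ := Nat.exists_eq_add_of_le' h1
    obtain ⟨x, rfl⟩ := Nat.exists_eq_add_of_le' h2
    obtain ⟨y, rfl⟩ := Nat.exists_eq_add_of_le' h3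
    obtain ⟨z, rfl⟩ := Nat.exists_eq_add_of_le' h4
    have hD : (w + 2) * (x + 2) - 1 = (w + 2) * (x + 1) + (w + 1) :=
      Nat.sub_eq_of_eq_add (by ring)
    simp [S49, Fin.forall_fin_succ, hD]
    and_intros <;> ring

/-! ### The region `c < 6` and its truncation -/

/-- A condition on exponents that persists when exponents decrease, as long as they stay at
least `2`. -/
def DownClosed (L : ℕ → ℕ → ℕ → ℕ → Prop) : Prop :=
  ∀ a b c d a' b' c' d', 2 ≤ a' → a' ≤ a → 2 ≤ b' → b' ≤ b → 2 ≤ c' → c' ≤ c → 2 ≤ d' → d' ≤ d →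
    L a b c d → L a' b' c' d'

/-- For slope at least `0` the value at `y` is at most the one at `x`; for negative slope it is
below `g 0 ≤ 0`. -/
theorem affine_neg_of_le {g : ℤ → ℤ} (hg : ∀ x, g x = g 0 + x * (g 1 - g 0)) (h0 : g 0 ≤ 0)
    {x y : ℤ} (hy : 0 < y) (hyx : y ≤ x) (hx : g x < 0) : g y < 0 := by
  rw [hg] at hx ⊢
  rcases le_or_gt 0 (g 1 - g 0) with h | h
  · nlinarith
  · nlinarith

/-- The region where a function that is affine in each variable is negative is closed downwards if
the function is not positive where a variable vanishes. -/
theorem downClosed_of_affine (f : ℤ → ℤ → ℤ → ℤ → ℤ)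
    (h1 : ∀ b c d x, f x b c d = f 0 b c d + x * (f 1 b c d - f 0 b c d))
    (h2 : ∀ a c d x, f a x c d = f a 0 c d + x * (f a 1 c d - f a 0 c d))
    (h3 : ∀ a b d x, f a b x d = f a b 0 d + x * (f a b 1 d - f a b 0 d))
    (h4 : ∀ a b c x, f a b c x = f a b c 0 + x * (f a b c 1 - f a b c 0))
    (h0 : ∀ x y z : ℕ, f 0 (x + 2) (y + 2) (z + 2) ≤ 0 ∧ f (x + 2) 0 (y + 2) (z + 2) ≤ 0 ∧
      f (x + 2) (y + 2) 0 (z + 2) ≤ 0 ∧ f (x + 2) (y + 2) (z + 2) 0 ≤ 0) :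
    DownClosed fun a b c d => f a b c d < 0 := by
  intro a b c d a' b' c' d' ha ha' hb hb' hc hc' hd hd' h
  obtain ⟨w, rfl⟩ := Nat.exists_eq_add_of_le' ha
  obtain ⟨x, rfl⟩ := Nat.exists_eq_add_of_le' hb
  obtain ⟨y, rfl⟩ := Nat.exists_eq_add_of_le' hc
  obtain ⟨z, rfl⟩ := Nat.exists_eq_add_of_le' hd
  obtain ⟨x', rfl⟩ := Nat.exists_eq_add_of_le' (hb.trans hb')
  obtain ⟨y', rfl⟩ := Nat.exists_eq_add_of_le' (hc.trans hc')
  obtain ⟨z', rfl⟩ := Nat.exists_eq_add_of_le' (hd.trans hd')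
  push_cast at h ⊢
  -- The exponents are lowered one at a time, the other three staying at least `2` throughout.
  have s1 : f (w + 2) (x' + 2) (y' + 2) (z' + 2) < 0 :=
    affine_neg_of_le (h1 _ _ _) (h0 _ _ _).1 (by positivity) (by exact_mod_cast ha') h
  have s2 : f (w + 2) (x + 2) (y' + 2) (z' + 2) < 0 :=
    affine_neg_of_le (g := fun t => f (w + 2) t (y' + 2) (z' + 2)) (h2 _ _ _) (h0 _ _ _).2.1
      (by positivity) (by exact_mod_cast hb') s1
  have s3 : f (w + 2) (x + 2) (y + 2) (z' + 2) < 0 :=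
    affine_neg_of_le (g := fun t => f (w + 2) (x + 2) t (z' + 2)) (h3 _ _ _) (h0 _ _ _).2.2.1
      (by positivity) (by exact_mod_cast hc') s2
  exact affine_neg_of_le (g := fun t => f (w + 2) (x + 2) (y + 2) t) (h4 _ _ _) (h0 _ _ _).2.2.2
    (by positivity) (by exact_mod_cast hd') s3

/-- To bound the exponents in a region that is closed downwards, truncate them at `B`. -/
theorem DownClosed.truncate {L F : ℕ → ℕ → ℕ → ℕ → Prop} (hL : DownClosed L) (B : ℕ) (hB : 2 ≤ B)
    (h : ∀ a ∈ List.range' 2 (B - 1), L a 2 2 2 → ∀ b ∈ List.range' 2 (B - 1), L a b 2 2 →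
      ∀ c ∈ List.range' 2 (B - 1), L a b c 2 → ∀ d ∈ List.range' 2 (B - 1), L a b c d → F a b c d)
    {a b c d : ℕ} (ha : 2 ≤ a) (hb : 2 ≤ b) (hc : 2 ≤ c) (hd : 2 ≤ d) (hl : L a b c d) :
    F (min a B) (min b B) (min c B) (min d B) := by
  have key : ∀ e, 2 ≤ e → 2 ≤ min e B ∧ min e B ≤ e ∧ min e B ∈ List.range' 2 (B - 1) := by
    intro e he
    rw [List.mem_range'_1]
    omega
  obtain ⟨a1, a2, a3⟩ := key a ha
  obtain ⟨b1, b2, b3⟩ := key b hb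
  obtain ⟨c1, c2, c3⟩ := key c hc
  obtain ⟨d1, d2, d3⟩ := key d hd
  exact h _ a3 (hL _ _ _ _ _ _ _ _ a1 a2 le_rfl hb le_rfl hc le_rfl hd hl)
    _ b3 (hL _ _ _ _ _ _ _ _ a1 a2 b1 b2 le_rfl hc le_rfl hd hl)
    _ c3 (hL _ _ _ _ _ _ _ _ a1 a2 b1 b2 c1 c2 le_rfl hd hl)
    _ d3 (hL _ _ _ _ _ _ _ _ a1 a2 b1 b2 c1 c2 d1 d2 hl)

/-- The inequality `c < 6` on `S41`. -/
abbrev Low41 (a b c d : ℕ) : Prop :=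
  a * b * c * d + a * d + d * c + b * c + 1 <
    a * b * d + a * d * c + d * b * c + d + a * b * c + c

/-- With one exponent set to `0` and the others written as `2` plus a natural number, the polynomial
has only non-positive coefficients. The same holds on the other skeletons below. -/
theorem downClosed_low41 : DownClosed Low41 := by
  have h := downClosed_of_affine (fun a b c d => a * b * c * d + a * d + d * c + b * c + 1 -
    (a * b * d + a * d * c + d * b * c + d + a * b * c + c))
    (by intros; ring) (by intros; ring) (by intros; ring) (by intros; ring) (by
      intro x y z
      have h1 : (0 : ℤ) ≤ x * y := by positivity
      have h2 : (0 : ℤ) ≤ x * z := by positivity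
      have h3 : (0 : ℤ) ≤ y * z := by positivity
      have h4 : (0 : ℤ) ≤ x * y * z := by positivity
      refine ⟨?_, ?_, ?_, ?_⟩ <;> linarith)
  intro a b c d a' b' c' d' ha ha' hb hb' hc hc' hd hd' hl
  have := h a b c d a' b' c' d' ha ha' hb hb' hc hc' hd hd' (by zify at hl; linarith)
  zify
  linarith

/-- The inequality `c < 6` on `S42`. -/
abbrev Low42 (a b c d : ℕ) : Prop :=
  a * b * c * d + c * d + a * d + a * b <
    a * c * d + b * c * d + a * b * d + a * b * c + a

theorem downClosed_low42 : DownClosed Low42 := by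
  have h := downClosed_of_affine (fun a b c d => a * b * c * d + c * d + a * d + a * b -
    (a * c * d + b * c * d + a * b * d + a * b * c + a))
    (by intros; ring) (by intros; ring) (by intros; ring) (by intros; ring) (by
      intro x y z
      have h1 : (0 : ℤ) ≤ x * y := by positivity
      have h2 : (0 : ℤ) ≤ x * z := by positivity
      have h3 : (0 : ℤ) ≤ y * z := by positivity
      have h4 : (0 : ℤ) ≤ x * y * z := by positivity
      refine ⟨?_, ?_, ?_, ?_⟩ <;> linarith)
  intro a b c d a' b' c' d' ha ha' hb hb' hc hc' hd hd' hl
  have := h a b c d a' b' c' d' ha ha' hb hb' hc hc' hd hd' (by zify at hl; linarith)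
  zify
  linarith

/-- The inequality `c < 6` on `S43`. -/
abbrev Low43 (a b c d : ℕ) : Prop :=
  a * b * c * d + c * d + a * d + a * c <
    b * c * d + d + a * c * d + a * b * d + a * b * c + a

theorem downClosed_low43 : DownClosed Low43 := by
  have h := downClosed_of_affine (fun a b c d => a * b * c * d + c * d + a * d + a * c -
    (b * c * d + d + a * c * d + a * b * d + a * b * c + a))
    (by intros; ring) (by intros; ring) (by intros; ring) (by intros; ring) (by
      intro x y z
      have h1 : (0 : ℤ) ≤ x * y := by positivity
      have h2 : (0 : ℤ) ≤ x * z := by positivity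
      have h3 : (0 : ℤ) ≤ y * z := by positivity
      have h4 : (0 : ℤ) ≤ x * y * z := by positivity
      refine ⟨?_, ?_, ?_, ?_⟩ <;> linarith)
  intro a b c d a' b' c' d' ha ha' hb hb' hc hc' hd hd' hl
  have := h a b c d a' b' c' d' ha ha' hb hb' hc hc' hd hd' (by zify at hl; linarith)
  zify
  linarith

/-- The inequality `c < 6` on `S45`. -/
abbrev Low45 (a b c d : ℕ) : Prop :=
  a * b * c * d + c * d + d * a + a * b + b * c + 3 <
    b * c * d + c * d * a + d * a * b + a * b * c + a + b + c + d

theorem downClosed_low45 : DownClosed Low45 := by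
  have h := downClosed_of_affine (fun a b c d => a * b * c * d + c * d + d * a + a * b + b * c + 3 -
    (b * c * d + c * d * a + d * a * b + a * b * c + a + b + c + d))
    (by intros; ring) (by intros; ring) (by intros; ring) (by intros; ring) (by
      intro x y z
      have h1 : (0 : ℤ) ≤ x * y := by positivity
      have h2 : (0 : ℤ) ≤ x * z := by positivity
      have h3 : (0 : ℤ) ≤ y * z := by positivity
      have h4 : (0 : ℤ) ≤ x * y * z := by positivity
      refine ⟨?_, ?_, ?_, ?_⟩ <;> linarith)
  intro a b c d a' b' c' d' ha ha' hb hb' hc hc' hd hd' hl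
  have := h a b c d a' b' c' d' ha ha' hb hb' hc hc' hd hd' (by zify at hl; linarith)
  zify
  linarith

/-- The inequality `c < 6` on `S46`. -/
abbrev Low46 (a b c d : ℕ) : Prop :=
  a * b * c * d + c * d + a * d + c + a * b <
    b * c * d + a * c * d + a * b * d + a * b * c + a

theorem downClosed_low46 : DownClosed Low46 := by
  have h := downClosed_of_affine (fun a b c d => a * b * c * d + c * d + a * d + c + a * b -
    (b * c * d + a * c * d + a * b * d + a * b * c + a))
    (by intros; ring) (by intros; ring) (by intros; ring) (by intros; ring) (by
      intro x y z
      have h1 : (0 : ℤ) ≤ x * y := by positivity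
      have h2 : (0 : ℤ) ≤ x * z := by positivity
      have h3 : (0 : ℤ) ≤ y * z := by positivity
      have h4 : (0 : ℤ) ≤ x * y * z := by positivity
      refine ⟨?_, ?_, ?_, ?_⟩ <;> linarith)
  intro a b c d a' b' c' d' ha ha' hb hb' hc hc' hd hd' hl
  have := h a b c d a' b' c' d' ha ha' hb hb' hc hc' hd hd' (by zify at hl; linarith)
  zify
  linarith

/-- The inequality `c < 6` on `S47`. -/
abbrev Low47 (a b c d : ℕ) : Prop :=
  a * b * c * d + c * d + a * d + b * d + b * c <
    b * c * d + a * c * d + a * b * d + 2 * d + a * b * c + c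

theorem downClosed_low47 : DownClosed Low47 := by
  have h := downClosed_of_affine (fun a b c d => a * b * c * d + c * d + a * d + b * d + b * c -
    (b * c * d + a * c * d + a * b * d + 2 * d + a * b * c + c))
    (by intros; ring) (by intros; ring) (by intros; ring) (by intros; ring) (by
      intro x y z
      have h1 : (0 : ℤ) ≤ x * y := by positivity
      have h2 : (0 : ℤ) ≤ x * z := by positivity
      have h3 : (0 : ℤ) ≤ y * z := by positivity
      have h4 : (0 : ℤ) ≤ x * y * z := by positivity
      refine ⟨?_, ?_, ?_, ?_⟩ <;> linarith)
  intro a b c d a' b' c' d' ha ha' hb hb' hc hc' hd hd' hl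
  have := h a b c d a' b' c' d' ha ha' hb hb' hc hc' hd hd' (by zify at hl; linarith)
  zify
  linarith

/-- The inequality `c < 6` on `S48`. -/
abbrev Low48 (a b c d : ℕ) : Prop :=
  a * b * c * d + c * d + a * d + b * c <
    b * c * d + a * c * d + a * b * d + a * b * c

theorem downClosed_low48 : DownClosed Low48 := by
  have h := downClosed_of_affine (fun a b c d => a * b * c * d + c * d + a * d + b * c -
    (b * c * d + a * c * d + a * b * d + a * b * c))
    (by intros; ring) (by intros; ring) (by intros; ring) (by intros; ring) (by
      intro x y z
      have h1 : (0 : ℤ) ≤ x * y := by positivity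
      have h2 : (0 : ℤ) ≤ x * z := by positivity
      have h3 : (0 : ℤ) ≤ y * z := by positivity
      have h4 : (0 : ℤ) ≤ x * y * z := by positivity
      refine ⟨?_, ?_, ?_, ?_⟩ <;> linarith)
  intro a b c d a' b' c' d' ha ha' hb hb' hc hc' hd hd' hl
  have := h a b c d a' b' c' d' ha ha' hb hb' hc hc' hd hd' (by zify at hl; linarith)
  zify
  linarith

/-! ### The chain `S41` -/

theorem isExponents_S41 (a b c d : ℕ) :
    S41.IsExponents ![a, b, c, d] ↔ 2 ≤ a ∧ 2 ≤ b ∧ 3 ≤ c ∧ 2 ≤ d := by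
  simp [Skeleton.IsExponents, S41, Fin.forall_fin_succ]

theorem isCharges_S41 (a b c d : ℕ) (p q r s : ℚ) : S41.IsCharges ![a, b, c, d] ![p, q, r, s] ↔
    a * p + q = 1 ∧ b * q + r = 1 ∧ c * r = 1 ∧ d * s + p = 1 := by
  simp [Skeleton.IsCharges, Skeleton.targetCharge, S41, Fin.forall_fin_succ]

theorem centralCharge_vec4_lt (p q r s : ℚ) :
    centralCharge ![p, q, r, s] < 6 ↔ 1 < p + q + r + s := by
  simp only [centralCharge, Fin.sum_univ_four, Matrix.cons_val]
  constructor <;> intro h <;> linarith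

theorem realized_family41 (a : Fin 7) (k : ℕ) : Realized S41 (family41 a k) := by
  fin_cases a <;> intro h
  all_goals
    simp only [family41, Fin.zero_eta, Fin.mk_one, Fin.reduceFinMk, Matrix.cons_val] at h ⊢
    rw [isExponents_S41] at h
    rw [isCharges_S41, centralCharge_vec4_lt]
    have hk : (2 : ℚ) ≤ k := by exact_mod_cast (by omega : 2 ≤ k)
    have hk0 : (k : ℚ) ≠ 0 := by positivity
    refine ⟨⟨?_, ?_, ?_, ?_⟩, ?_⟩
    · push_cast; field_simp; try ring
    · push_cast; field_simp; try ring
    · push_cast; field_simp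
    · push_cast; field_simp; try ring
    · rw [← sub_pos]
      field_simp
      ring_nf
      linarith

theorem realized_family41' (k l : ℕ) : Realized S41 (family41' k l) := by
  intro h
  simp only [family41'] at h ⊢
  rw [isExponents_S41] at h
  rw [isCharges_S41, centralCharge_vec4_lt]
  have hk : (0 : ℚ) < k := by exact_mod_cast (by omega : 0 < k)
  have hl : (0 : ℚ) < l := by exact_mod_cast (by omega : 0 < l)
  refine ⟨⟨?_, ?_, ?_, ?_⟩, ?_⟩
  · field_simp; ring
  · push_cast; field_simp; ring
  · field_simp
  · push_cast; field_simp; ring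
  · rw [← sub_pos]
    field_simp
    ring_nf
    positivity

theorem exists_family41_mem (a : Fin 7) (N : ℕ) :
    ∃ k ≥ N, (family41 a k).1 ∈ S41.irreducibleExponents := by
  -- The pointer charges that tend to `0` are `7 / (9k)`, `2 / (3k)` and `3 / (4k)`; `k ≡ 1` modulo
  -- `42` keeps `k` prime to `7`, `2` and `3`. For every other pointer charge, `D / N i` lies
  -- strictly between consecutive integers.
  refine ⟨42 * N + 43, by omega, ?_⟩
  fin_cases a <;>
    simp only [family41, Fin.zero_eta, Fin.mk_one, Fin.reduceFinMk, Matrix.cons_val] <;>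
    rw [mem_S41] <;> norm_num
  · refine ⟨?_, ?_, ?_, by omega⟩
    · omega
    · exact Nat.not_dvd_of_lt_of_lt_mul_succ (k := 4) (by omega) (by omega)
    · exact Nat.not_dvd_of_lt_of_lt_mul_succ (k := 2) (by omega) (by omega)
  · refine ⟨?_, ?_, ?_, by omega⟩
    · exact Nat.not_dvd_of_lt_of_lt_mul_succ (k := 3) (by omega) (by omega)
    · exact Nat.not_dvd_of_lt_of_lt_mul_succ (k := 2) (by omega) (by omega)
    · exact Nat.not_dvd_of_lt_of_lt_mul_succ (k := 4) (by omega) (by omega)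
  · refine ⟨?_, ?_, ?_, by omega⟩
    · exact Nat.not_dvd_of_lt_of_lt_mul_succ (k := 2) (by omega) (by omega)
    · exact Nat.not_dvd_of_lt_of_lt_mul_succ (k := 3) (by omega) (by omega)
    · exact Nat.not_dvd_of_lt_of_lt_mul_succ (k := 3) (by omega) (by omega)
  · refine ⟨?_, ?_, ?_, by omega⟩
    · exact Nat.not_dvd_of_lt_of_lt_mul_succ (k := 2) (by omega) (by omega)
    · omega
    · exact Nat.not_dvd_of_lt_of_lt_mul_succ (k := 3) (by omega) (by omega)
  · refine ⟨?_, ?_, ?_, by omega⟩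
    · exact Nat.not_dvd_of_lt_of_lt_mul_succ (k := 2) (by omega) (by omega)
    · omega
    · exact Nat.not_dvd_of_lt_of_lt_mul_succ (k := 5) (by omega) (by omega)
  · refine ⟨?_, ?_, ?_, by omega⟩
    · exact Nat.not_dvd_of_lt_of_lt_mul_succ (k := 3) (by omega) (by omega)
    · omega
    · exact Nat.not_dvd_of_lt_of_lt_mul_succ (k := 2) (by omega) (by omega)
  · refine ⟨?_, ?_, ?_, by omega⟩
    · exact Nat.not_dvd_of_lt_of_lt_mul_succ (k := 2) (by omega) (by omega)
    · omega
    · exact Nat.not_dvd_of_lt_of_lt_mul_succ (k := 3) (by omega) (by omega)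

theorem exists_family41'_mem (N : ℕ) :
    ∃ k ≥ N, ∃ l ≥ N, (family41' k l).1 ∈ S41.irreducibleExponents := by
  -- Irreducibility at the first node amounts to `l + 1 ∤ 2 * k * l`, that is `l + 1 ∤ 2 * k`; the
  -- choice `l = 2 * k` makes the divisor too large.
  refine ⟨N + 4, by omega, 2 * N + 8, by omega, ?_⟩
  simp only [family41']
  rw [mem_S41]
  refine ⟨by omega, by omega, by omega, by omega, ?_, ?_, ?_, ?_⟩
  · rintro ⟨t, ht⟩
    have h1 : 2 * N + 9 ∣ 2 * (N + 4) := by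
      have h2 : (2 * N + 9) * (2 * (N + 4)) = (2 * N + 9) * t + 2 * (N + 4) := by
        norm_num at ht
        nlinarith
      exact (Nat.dvd_add_right (Dvd.intro _ rfl)).1 (h2 ▸ Dvd.intro _ rfl)
    have := Nat.le_of_dvd (by omega) h1
    omega
  · refine Nat.not_dvd_of_lt_of_lt_mul_succ (k := 2) ?_ ?_ <;> norm_num <;> nlinarith
  · refine Nat.not_dvd_of_lt_of_lt_mul_succ (k := 2) ?_ ?_ <;> norm_num <;> nlinarith
  · norm_num
    nlinarith

/-- The exponents on `S41` outside the families. -/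
def sporadicList41 : List (ℕ × ℕ × ℕ × ℕ) :=
  [(2, 2, 4, 4), (2, 2, 4, 5), (2, 2, 4, 6), (2, 2, 4, 7), (2, 2, 4, 8), (2, 2, 4, 9), (2, 2,
   4, 10), (2, 2, 5, 4), (2, 2, 5, 5), (2, 2, 5, 6), (2, 2, 6, 4), (2, 2, 6, 5), (2, 2, 7, 4),
   (2, 2, 8, 4), (2, 2, 9, 4), (2, 2, 10, 4), (2, 3, 3, 4), (2, 3, 3, 5), (2, 3, 3, 6), (2, 3,
   3, 7), (2, 3, 3, 8), (2, 3, 3, 9), (2, 3, 3, 10), (2, 3, 5, 3), (2, 3, 6, 3), (2, 4, 4, 3),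
   (2, 4, 6, 2), (2, 4, 7, 2), (2, 4, 8, 2), (2, 4, 9, 2), (2, 4, 10, 2), (2, 4, 11, 2), (2,
   4, 12, 2), (2, 5, 3, 4), (2, 5, 3, 5), (2, 5, 4, 3), (2, 5, 5, 2), (2, 5, 7, 2), (2, 5, 8,
   2), (2, 6, 5, 2), (2, 6, 6, 2), (2, 7, 3, 4), (2, 7, 5, 2), (2, 7, 6, 2), (2, 9, 3, 4), (2,
   9, 5, 2), (2, 10, 5, 2), (2, 11, 5, 2), (3, 2, 4, 3), (3, 2, 4, 4), (3, 2, 6, 3), (3, 2, 7,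
   3), (3, 2, 8, 3), (3, 2, 9, 3), (3, 2, 10, 3), (3, 3, 3, 3), (3, 3, 5, 2), (3, 3, 6, 2),
   (3, 3, 7, 2), (3, 3, 8, 2), (3, 3, 9, 2), (3, 3, 10, 2), (3, 3, 11, 2), (3, 3, 12, 2), (3,
   4, 4, 2), (3, 4, 6, 2), (3, 5, 4, 2), (3, 7, 4, 2), (4, 2, 4, 3), (4, 2, 5, 3), (4, 2, 6,
   3), (4, 3, 3, 3), (4, 3, 5, 2), (4, 3, 6, 2), (4, 3, 7, 2), (4, 3, 8, 2), (4, 4, 4, 2), (4,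
   5, 3, 2), (4, 5, 4, 2), (4, 7, 3, 2), (4, 9, 3, 2), (4, 11, 3, 2), (4, 13, 3, 2), (5, 2, 5,
   3), (5, 3, 5, 2), (5, 3, 6, 2), (5, 4, 4, 2), (5, 5, 3, 2), (5, 7, 3, 2), (6, 2, 4, 3), (6,
   3, 5, 2), (6, 3, 6, 2), (6, 4, 4, 2), (6, 5, 3, 2), (6, 7, 3, 2), (7, 2, 4, 3), (7, 3, 5,
   2), (7, 5, 3, 2), (8, 2, 4, 3), (8, 3, 5, 2), (8, 5, 3, 2), (9, 2, 4, 3), (9, 3, 5, 2), (9,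
   5, 3, 2), (10, 3, 5, 2), (10, 5, 3, 2), (11, 5, 3, 2), (12, 5, 3, 2)]

/-- The tuple of four exponents as a function. -/
def toFun4 (p : ℕ × ℕ × ℕ × ℕ) : Fin 4 → ℕ := ![p.1, p.2.1, p.2.2.1, p.2.2.2]

theorem toFun4_injective : Function.Injective toFun4 := by
  rintro ⟨a, b, c, d⟩ ⟨a', b', c', d'⟩ h
  have h0 := congrFun h 0
  have h1 := congrFun h 1
  have h2 := congrFun h 2
  have h3 := congrFun h 3
  simp only [toFun4, Matrix.cons_val] at h0 h1 h2 h3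
  subst h0 h1 h2 h3
  rfl

/-- The exponents belong to one of the families on `S41`. -/
abbrev InFamily41 (a b c d : ℕ) : Prop :=
  (b = 3 ∧ c = 3 ∧ d = 2) ∨ (a = 2 ∧ b = 2 ∧ d = 3) ∨ (a = 2 ∧ b = 3 ∧ d = 2) ∨
    (a = 2 ∧ c = 3 ∧ d = 2) ∨ (a = 2 ∧ c = 3 ∧ d = 3) ∨ (a = 3 ∧ c = 3 ∧ d = 2) ∨
    (a = 2 ∧ c = 4 ∧ d = 2) ∨ (b = 2 ∧ d = 2)

theorem inFamily41_iff (a b c d : ℕ) : InFamily41 a b c d ↔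
    (∃ i k, ![a, b, c, d] = (family41 i k).1) ∨ ∃ k l, ![a, b, c, d] = (family41' k l).1 := by
  simp [Fin.exists_fin_succ, family41, family41', InFamily41, or_assoc]

/-- Membership only fixes some exponents at values up to `4`, below the truncation bound, and leaves
the others free. -/
theorem inFamily41_of_min {a b c d : ℕ}
    (h : InFamily41 (min a 14) (min b 14) (min c 14) (min d 14)) : InFamily41 a b c d := by
  have e : ∀ x j, j < 14 → min x 14 = j → x = j := by omega
  rcases h with ⟨h1, h2, h3⟩ | ⟨h1, h2, h3⟩ | ⟨h1, h2, h3⟩ | ⟨h1, h2, h3⟩ | ⟨h1, h2, h3⟩ |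
    ⟨h1, h2, h3⟩ | ⟨h1, h2, h3⟩ | ⟨h1, h2⟩
  all_goals
    have h1 := e _ _ (by norm_num) h1
    have h2 := e _ _ (by norm_num) h2
    try have h3 := e _ _ (by norm_num) h3
    subst_vars
    simp [InFamily41]

/-- What remains of the region `c < 6` on `S41` below the truncation. -/
def Remains41 (a b c d : ℕ) : Prop :=
  c < 3 ∨ (b < 14 ∧ c < 14 ∧ c - 1 ∣ b * c) ∨
    (a < 14 ∧ b < 14 ∧ c < 14 ∧ (b - 1) * c + 1 ∣ a * b * c) ∨
    (a < 14 ∧ b < 14 ∧ c < 14 ∧ d < 14 ∧ (a - 1) * b * c + (c - 1) ∣ a * b * c * d) ∨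
    InFamily41 a b c d ∨ (a, b, c, d) ∈ sporadicList41

instance (a b c d : ℕ) : Decidable (Remains41 a b c d) := by
  unfold Remains41
  infer_instance

/-- The second charge depends only on `b, c` and the first only on `a, b, c`, so their divisibility
clauses apply with the remaining exponents unbounded. The clause `c < 3` covers tuples of the box
that are not admissible at the root. -/
theorem remains41 : ∀ a ∈ List.range' 2 13, Low41 a 2 2 2 → ∀ b ∈ List.range' 2 13,
    Low41 a b 2 2 → ∀ c ∈ List.range' 2 13, Low41 a b c 2 → ∀ d ∈ List.range' 2 13,
    Low41 a b c d → Remains41 a b c d := by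
  decide +kernel

theorem mem_sporadicList41 : ∀ p ∈ sporadicList41, p.1 < 14 ∧ p.2.1 < 14 ∧ p.2.2.1 < 14 ∧
    p.2.2.2 < 14 ∧ ¬ InFamily41 p.1 p.2.1 p.2.2.1 p.2.2.2 ∧
    2 ≤ p.1 ∧ 2 ≤ p.2.1 ∧ 3 ≤ p.2.2.1 ∧ 2 ≤ p.2.2.2 ∧
    ¬ p.2.2.2 * ((p.2.1 - 1) * p.2.2.1 + 1) ∣ p.1 * p.2.1 * p.2.2.1 * p.2.2.2 ∧
    ¬ p.1 * p.2.2.2 * (p.2.2.1 - 1) ∣ p.1 * p.2.1 * p.2.2.1 * p.2.2.2 ∧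
    ¬ (p.1 - 1) * p.2.1 * p.2.2.1 + (p.2.2.1 - 1) ∣ p.1 * p.2.1 * p.2.2.1 * p.2.2.2 ∧
    p.1 * p.2.1 * p.2.2.1 * p.2.2.2 <
      p.2.2.2 * ((p.2.1 - 1) * p.2.2.1 + 1) + p.1 * p.2.2.2 * (p.2.2.1 - 1) +
        p.1 * p.2.1 * p.2.2.2 + ((p.1 - 1) * p.2.1 * p.2.2.1 + (p.2.2.1 - 1)) := by
  decide +kernel

theorem sporadic41_eq : sporadic41 = toFun4 '' {p | p ∈ sporadicList41} := by
  ext m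
  obtain ⟨a, b, c, d, rfl⟩ : ∃ a b c d, m = ![a, b, c, d] := ⟨_, _, _, _, eq_vec4 m⟩
  have hfam : ((∀ i k, ![a, b, c, d] ≠ (family41 i k).1) ∧
      ∀ k l, ![a, b, c, d] ≠ (family41' k l).1) ↔ ¬ InFamily41 a b c d := by
    rw [inFamily41_iff]
    push Not
    rfl
  constructor
  · rintro ⟨hm, hf⟩
    rw [hfam] at hf
    rw [mem_S41] at hm
    obtain ⟨ha, hb, hc, hd, h0, h1, h3, hlt⟩ := hm
    have hlow : Low41 a b c d := by
      obtain ⟨x, rfl⟩ := Nat.exists_eq_add_of_le' ha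
      obtain ⟨y, rfl⟩ := Nat.exists_eq_add_of_le' hb
      obtain ⟨z, rfl⟩ := Nat.exists_eq_add_of_le' hc
      simp only [Nat.add_succ_sub_one] at hlt
      unfold Low41
      linarith
    have hr := downClosed_low41.truncate (F := Remains41) 14 (by norm_num) remains41
      ha hb (by omega) hd hlow
    -- An exponent whose truncation is below the bound is unchanged by it.
    have ea : min a 14 < 14 → min a 14 = a := by omega
    have eb : min b 14 < 14 → min b 14 = b := by omega
    have ec : min c 14 < 14 → min c 14 = c := by omega
    have ed : min d 14 < 14 → min d 14 = d := by omega
    rcases hr with h | ⟨hb', hc', h⟩ | ⟨ha', hb', hc', h⟩ | ⟨ha', hb', hc', hd', h⟩ | h | h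
    · omega
    · rw [eb hb', ec hc'] at h
      refine absurd ?_ h1
      have := Nat.mul_dvd_mul_left (a * d) h
      convert this using 1
      ring
    · rw [ea ha', eb hb', ec hc'] at h
      refine absurd ?_ h0
      have := Nat.mul_dvd_mul_left d h
      convert this using 1
      ring
    · rw [ea ha', eb hb', ec hc', ed hd'] at h
      exact absurd h h3
    · exact absurd (inFamily41_of_min h) hf
    · have h' := mem_sporadicList41 _ h
      rw [ea h'.1, eb h'.2.1, ec h'.2.2.1, ed h'.2.2.2.1] at h
      exact ⟨(a, b, c, d), h, rfl⟩
  · rintro ⟨p, hp, hpm⟩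
    obtain rfl : p = (a, b, c, d) := toFun4_injective hpm
    obtain ⟨-, -, -, -, hf, h⟩ := mem_sporadicList41 _ hp
    exact ⟨(mem_S41 a b c d).2 h, hfam.2 hf⟩

theorem sporadic41_finite : sporadic41.Finite := by
  rw [sporadic41_eq]
  exact (List.finite_toSet _).image _

theorem ncard_sporadic41 : sporadic41.ncard = 108 := by
  have h : {p | p ∈ sporadicList41} = (↑(sporadicList41.toFinset) : Set (ℕ × ℕ × ℕ × ℕ)) := by
    ext p; simp
  rw [sporadic41_eq, Set.ncard_image_of_injective _ toFun4_injective, h, Set.ncard_coe_finset]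
  decide +kernel

theorem isGreatest_sporadic41 : IsGreatest {e | ∃ m ∈ sporadic41, ∃ i, m i = e} 13 := by
  rw [sporadic41_eq]
  constructor
  · exact ⟨_, ⟨(4, 13, 3, 2), by decide, rfl⟩, 1, rfl⟩
  · rintro e ⟨_, ⟨p, hp, rfl⟩, i, rfl⟩
    have h := mem_sporadicList41 p hp
    fin_cases i <;> (simp [toFun4]; omega)

/-! ### The four-cycle `S45` -/

theorem isExponents_S45 (a b c d : ℕ) :
    S45.IsExponents ![a, b, c, d] ↔ 2 ≤ a ∧ 2 ≤ b ∧ 2 ≤ c ∧ 2 ≤ d := by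
  simp [Skeleton.IsExponents, S45, Fin.forall_fin_succ]

theorem isCharges_S45 (a b c d : ℕ) (p q r s : ℚ) : S45.IsCharges ![a, b, c, d] ![p, q, r, s] ↔
    a * p + q = 1 ∧ b * q + r = 1 ∧ c * r + s = 1 ∧ d * s + p = 1 := by
  simp [Skeleton.IsCharges, Skeleton.targetCharge, S45, Fin.forall_fin_succ]

theorem realized_family45 (a : Fin 2) (k : ℕ) : Realized S45 (family45 a k) := by
  fin_cases a <;> intro h
  all_goals
    simp only [family45, Fin.zero_eta, Fin.mk_one, Matrix.cons_val] at h ⊢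
    rw [isExponents_S45] at h
    rw [isCharges_S45, centralCharge_vec4_lt]
    have hk : (2 : ℚ) ≤ k := by exact_mod_cast (by omega : 2 ≤ k)
    have hk1 : (0 : ℚ) < 12 * k - 1 := by linarith
    have hk0 : (12 * k - 1 : ℚ) ≠ 0 := hk1.ne'
    refine ⟨⟨?_, ?_, ?_, ?_⟩, ?_⟩
    · rw [← mul_div_assoc, ← add_div, div_eq_one_iff_eq hk0]; push_cast; ring
    · rw [← mul_div_assoc, ← add_div, div_eq_one_iff_eq hk0]; push_cast; ring
    · rw [← mul_div_assoc, ← add_div, div_eq_one_iff_eq hk0]; push_cast; ring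
    · rw [← mul_div_assoc, ← add_div, div_eq_one_iff_eq hk0]; ring
    · rw [← add_div, ← add_div, ← add_div, lt_div_iff₀ hk1]
      linarith

theorem realized_family45' (k l : ℕ) : Realized S45 (family45' k l) := by
  intro h
  simp only [family45'] at h ⊢
  rw [isExponents_S45] at h
  rw [isCharges_S45, centralCharge_vec4_lt]
  have hk : (2 : ℚ) ≤ k := by exact_mod_cast (by omega : 2 ≤ k)
  have hl : (2 : ℚ) ≤ l := by exact_mod_cast (by omega : 2 ≤ l)
  have hk1 : (0 : ℚ) < 4 * k * l - 1 := by nlinarith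
  have hk0 : (4 * k * l - 1 : ℚ) ≠ 0 := hk1.ne'
  refine ⟨⟨?_, ?_, ?_, ?_⟩, ?_⟩
  · rw [← mul_div_assoc, ← add_div, div_eq_one_iff_eq hk0]; push_cast; ring
  · rw [← mul_div_assoc, ← add_div, div_eq_one_iff_eq hk0]; ring
  · rw [← mul_div_assoc, ← add_div, div_eq_one_iff_eq hk0]; push_cast; ring
  · rw [← mul_div_assoc, ← add_div, div_eq_one_iff_eq hk0]; ring
  · rw [← add_div, ← add_div, ← add_div, lt_div_iff₀ hk1]
    linarith

theorem exists_family45_mem (a : Fin 2) (N : ℕ) :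
    ∃ k ≥ N, (family45 a k).1 ∈ S45.irreducibleExponents := by
  refine ⟨N + 10, by omega, ?_⟩
  fin_cases a <;> simp only [family45, Fin.zero_eta, Fin.mk_one, Matrix.cons_val] <;>
    rw [mem_S45] <;> norm_num
  · refine ⟨?_, ?_, ?_, ?_, by omega⟩
    · exact Nat.not_dvd_of_lt_of_lt_mul_succ (k := 4) (by omega) (by omega)
    · exact Nat.not_dvd_of_lt_of_lt_mul_succ (k := 3) (by omega) (by omega)
    · exact Nat.not_dvd_of_lt_of_lt_mul_succ (k := 2) (by omega) (by omega)
    -- `12 * k - 1` is `2` modulo `3`, so `9` does not divide it; in the second family it is odd, so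
    -- `8` does not.
    · omega
  · refine ⟨?_, ?_, ?_, ?_, by omega⟩
    · exact Nat.not_dvd_of_lt_of_lt_mul_succ (k := 3) (by omega) (by omega)
    · exact Nat.not_dvd_of_lt_of_lt_mul_succ (k := 2) (by omega) (by omega)
    · exact Nat.not_dvd_of_lt_of_lt_mul_succ (k := 3) (by omega) (by omega)
    · omega

theorem exists_family45'_mem (N : ℕ) :
    ∃ k ≥ N, ∃ l ≥ N, (family45' k l).1 ∈ S45.irreducibleExponents := by
  -- From `D + (2k + 1) = 2k(2l + 1)` and its mirror image, reducibility at the second or fourth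
  -- node would need `2l + 1 ∣ 2k + 1` or `2k + 1 ∣ 2l + 1`. With `l = k + 1` these odd numbers
  -- differ by `2`, so neither happens.
  refine ⟨N + 4, by omega, N + 5, by omega, ?_⟩
  simp only [family45']
  have hD : 2 * (N + 4) * 2 * (N + 5) - 1 = 4 * N ^ 2 + 36 * N + 79 :=
    Nat.sub_eq_of_eq_add (by ring)
  rw [mem_S45, hD]
  refine ⟨by omega, by omega, by omega, by omega, ?_, ?_, ?_, ?_, ?_⟩
  · refine Nat.not_dvd_of_lt_of_lt_mul_succ (k := 2) ?_ ?_ <;> norm_num <;> nlinarith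
  · norm_num
    intro h
    have h1 : (N + 5) * 2 + 1 ∣ 2 * N + 9 := by
      refine (Nat.dvd_add_right h).1 ⟨2 * (N + 4), ?_⟩
      ring
    have := Nat.le_of_dvd (by omega) h1
    omega
  · refine Nat.not_dvd_of_lt_of_lt_mul_succ (k := 2) ?_ ?_ <;> norm_num <;> nlinarith
  · norm_num
    intro h
    have h1 : (N + 4) * 2 + 1 ∣ 2 * N + 11 := by
      refine (Nat.dvd_add_right h).1 ⟨2 * (N + 5), ?_⟩
      ring
    have h2 : (N + 4) * 2 + 1 ∣ 2 := by
      refine (Nat.dvd_add_right (dvd_refl _)).1 (?_ : _ ∣ (N + 4) * 2 + 1 + 2)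
      convert h1 using 1
      ring
    have := Nat.le_of_dvd (by omega) h2
    omega
  · norm_num
    nlinarith

/-- The exponents on `S45` outside the families, up to rotation. -/
def sporadicList45 : List (ℕ × ℕ × ℕ × ℕ) :=
  [(2, 2, 4, 4), (2, 2, 4, 5), (2, 2, 4, 6), (2, 2, 4, 7), (2, 2, 4, 8), (2, 2, 5, 4), (2, 2,
   5, 5), (2, 2, 6, 4), (2, 2, 7, 4), (2, 2, 8, 4), (2, 3, 3, 3), (2, 3, 3, 4), (2, 3, 3, 5),
   (2, 3, 3, 6), (2, 3, 3, 7), (2, 3, 4, 3), (2, 3, 5, 3), (2, 4, 3, 3), (2, 4, 3, 4), (2, 5,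
   3, 3), (2, 6, 3, 3), (2, 7, 3, 3)]

/-- The rotations of a tuple of four exponents. -/
def rotations (p : ℕ × ℕ × ℕ × ℕ) : List (ℕ × ℕ × ℕ × ℕ) :=
  [(p.1, p.2.1, p.2.2.1, p.2.2.2), (p.2.1, p.2.2.1, p.2.2.2, p.1),
    (p.2.2.1, p.2.2.2, p.1, p.2.1), (p.2.2.2, p.1, p.2.1, p.2.2.1)]

theorem toFun4_mem_cyclicClass (p q : ℕ × ℕ × ℕ × ℕ) :
    toFun4 p ∈ cyclicClass (toFun4 q) ↔ p ∈ rotations q := by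
  obtain ⟨a, b, c, d⟩ := p
  obtain ⟨a', b', c', d'⟩ := q
  simp [cyclicClass, toFun4, rotations, Fin.exists_fin_succ, Fin.forall_fin_succ]

theorem vec4_mem_cyclicClass (a b c d p q r s : ℕ) :
    ![a, b, c, d] ∈ cyclicClass ![p, q, r, s] ↔
      (a = p ∧ b = q ∧ c = r ∧ d = s) ∨ (a = q ∧ b = r ∧ c = s ∧ d = p) ∨
        (a = r ∧ b = s ∧ c = p ∧ d = q) ∨ (a = s ∧ b = p ∧ c = q ∧ d = r) := by
  have := toFun4_mem_cyclicClass (a, b, c, d) (p, q, r, s)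
  simpa [toFun4, rotations] using this

theorem mem_cyclicClass_self (m : Fin 4 → ℕ) : m ∈ cyclicClass m := ⟨0, fun i => by simp⟩

theorem cyclicClass_eq {m m' : Fin 4 → ℕ} (h : m' ∈ cyclicClass m) :
    cyclicClass m' = cyclicClass m := by
  obtain ⟨r, hr⟩ := h
  ext x
  constructor
  · rintro ⟨s, hs⟩
    exact ⟨s + r, fun i => by rw [hs, hr, add_assoc]⟩
  · rintro ⟨s, hs⟩
    exact ⟨s - r, fun i => by rw [hs, hr, add_assoc, sub_add_cancel]⟩

/-- The exponents are a rotation of a member of one of the families on `S45`. -/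
abbrev InFamily45 (a b c d : ℕ) : Prop :=
  (a = 3 ∧ b = 2 ∧ c = 2) ∨ (b = 3 ∧ c = 2 ∧ d = 2) ∨ (c = 3 ∧ d = 2 ∧ a = 2) ∨
    (d = 3 ∧ a = 2 ∧ b = 2) ∨ (a = 2 ∧ b = 2 ∧ c = 3) ∨ (b = 2 ∧ c = 2 ∧ d = 3) ∨
    (c = 2 ∧ d = 2 ∧ a = 3) ∨ (d = 2 ∧ a = 2 ∧ b = 3) ∨ (a = 2 ∧ c = 2) ∨ (b = 2 ∧ d = 2)

theorem inFamily45_iff (a b c d : ℕ) : InFamily45 a b c d ↔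
    (∃ i k, ![a, b, c, d] ∈ cyclicClass (family45 i k).1) ∨
      ∃ k l, ![a, b, c, d] ∈ cyclicClass (family45' k l).1 := by
  simp only [Fin.exists_fin_two, family45, family45', Matrix.cons_val, vec4_mem_cyclicClass,
    InFamily45]
  constructor
  · rintro (h | h | h | h | h | h | h | h | h | h)
    · exact Or.inl (Or.inl ⟨d, by omega⟩)
    · exact Or.inl (Or.inl ⟨a, by omega⟩)
    · exact Or.inl (Or.inl ⟨b, by omega⟩)
    · exact Or.inl (Or.inl ⟨c, by omega⟩)
    · exact Or.inl (Or.inr ⟨d, by omega⟩)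
    · exact Or.inl (Or.inr ⟨a, by omega⟩)
    · exact Or.inl (Or.inr ⟨b, by omega⟩)
    · exact Or.inl (Or.inr ⟨c, by omega⟩)
    · exact Or.inr ⟨b, d, by omega⟩
    · exact Or.inr ⟨c, a, by omega⟩
  · rintro ((⟨k, h | h | h | h⟩ | ⟨k, h | h | h | h⟩) | ⟨k, l, h | h | h | h⟩) <;>
      obtain ⟨rfl, rfl, rfl, rfl⟩ := h <;> simp

theorem inFamily45_of_min {a b c d : ℕ}
    (h : InFamily45 (min a 9) (min b 9) (min c 9) (min d 9)) : InFamily45 a b c d := by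
  have e : ∀ x j, j < 9 → (min x 9 = j ↔ x = j) := by omega
  simpa only [InFamily45, e _ 2 (by norm_num), e _ 3 (by norm_num)] using h

/-- What remains of the region `c < 6` on `S45` below the truncation. -/
def Remains45 (a b c d : ℕ) : Prop :=
  InFamily45 a b c d ∨ (a < 9 ∧ b < 9 ∧ c < 9 ∧ d < 9 ∧
    ((b - 1) * c * d + (d - 1) ∣ a * b * c * d - 1 ∨
      (c - 1) * d * a + (a - 1) ∣ a * b * c * d - 1 ∨
      (d - 1) * a * b + (b - 1) ∣ a * b * c * d - 1 ∨
      (a - 1) * b * c + (c - 1) ∣ a * b * c * d - 1 ∨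
      (a, b, c, d) ∈ sporadicList45.flatMap rotations))

instance (a b c d : ℕ) : Decidable (Remains45 a b c d) := by
  unfold Remains45
  infer_instance

/-- Every charge involves all four exponents, so no divisibility clause could leave one free; none
is needed, as an exponent of at least `9` in the region already forces a family. -/
theorem remains45 : ∀ a ∈ List.range' 2 8, Low45 a 2 2 2 → ∀ b ∈ List.range' 2 8,
    Low45 a b 2 2 → ∀ c ∈ List.range' 2 8, Low45 a b c 2 → ∀ d ∈ List.range' 2 8,
    Low45 a b c d → Remains45 a b c d := by
  decide +kernel

theorem mem_sporadicList45 : ∀ p ∈ sporadicList45.flatMap rotations, p.1 ≤ 8 ∧ p.2.1 ≤ 8 ∧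
    p.2.2.1 ≤ 8 ∧ p.2.2.2 ≤ 8 ∧ ¬ InFamily45 p.1 p.2.1 p.2.2.1 p.2.2.2 ∧
    2 ≤ p.1 ∧ 2 ≤ p.2.1 ∧ 2 ≤ p.2.2.1 ∧ 2 ≤ p.2.2.2 ∧
    ¬ (p.2.1 - 1) * p.2.2.1 * p.2.2.2 + (p.2.2.2 - 1) ∣ p.1 * p.2.1 * p.2.2.1 * p.2.2.2 - 1 ∧
    ¬ (p.2.2.1 - 1) * p.2.2.2 * p.1 + (p.1 - 1) ∣ p.1 * p.2.1 * p.2.2.1 * p.2.2.2 - 1 ∧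
    ¬ (p.2.2.2 - 1) * p.1 * p.2.1 + (p.2.1 - 1) ∣ p.1 * p.2.1 * p.2.2.1 * p.2.2.2 - 1 ∧
    ¬ (p.1 - 1) * p.2.1 * p.2.2.1 + (p.2.2.1 - 1) ∣ p.1 * p.2.1 * p.2.2.1 * p.2.2.2 - 1 ∧
    p.1 * p.2.1 * p.2.2.1 * p.2.2.2 - 1 <
      ((p.2.1 - 1) * p.2.2.1 * p.2.2.2 + (p.2.2.2 - 1)) +
        ((p.2.2.1 - 1) * p.2.2.2 * p.1 + (p.1 - 1)) +
        ((p.2.2.2 - 1) * p.1 * p.2.1 + (p.2.1 - 1)) +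
        ((p.1 - 1) * p.2.1 * p.2.2.1 + (p.2.2.1 - 1)) := by
  decide +kernel

theorem sporadic45_eq :
    sporadic45 = toFun4 '' {p | p ∈ sporadicList45.flatMap rotations} := by
  ext m
  obtain ⟨a, b, c, d, rfl⟩ : ∃ a b c d, m = ![a, b, c, d] := ⟨_, _, _, _, eq_vec4 m⟩
  have hfam : ((∀ i k, ![a, b, c, d] ∉ cyclicClass (family45 i k).1) ∧
      ∀ k l, ![a, b, c, d] ∉ cyclicClass (family45' k l).1) ↔ ¬ InFamily45 a b c d := by
    rw [inFamily45_iff]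
    push Not
    rfl
  constructor
  · rintro ⟨hm, hf⟩
    rw [hfam] at hf
    rw [mem_S45] at hm
    obtain ⟨ha, hb, hc, hd, h0, h1, h2, h3, hlt⟩ := hm
    have hlow : Low45 a b c d := by
      obtain ⟨w, rfl⟩ := Nat.exists_eq_add_of_le' ha
      obtain ⟨x, rfl⟩ := Nat.exists_eq_add_of_le' hb
      obtain ⟨y, rfl⟩ := Nat.exists_eq_add_of_le' hc
      obtain ⟨z, rfl⟩ := Nat.exists_eq_add_of_le' hd
      have := lt_add_of_tsub_lt_right hlt
      simp only [Nat.add_succ_sub_one] at this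
      unfold Low45
      linarith
    have hr := downClosed_low45.truncate (F := Remains45) 9 (by norm_num) remains45
      ha hb hc hd hlow
    have e : ∀ x, min x 9 < 9 → min x 9 = x := by omega
    rcases hr with h | ⟨ha', hb', hc', hd', h⟩
    · exact absurd (inFamily45_of_min h) hf
    · rw [e a ha', e b hb', e c hc', e d hd'] at h
      rcases h with h | h | h | h | h
      · exact absurd h h0
      · exact absurd h h1
      · exact absurd h h2
      · exact absurd h h3
      · exact ⟨(a, b, c, d), h, rfl⟩
  · rintro ⟨p, hp, hpm⟩
    obtain rfl : p = (a, b, c, d) := toFun4_injective hpm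
    obtain ⟨-, -, -, -, hf, h⟩ := mem_sporadicList45 _ hp
    exact ⟨(mem_S45 a b c d).2 h, hfam.2 hf⟩

theorem sporadic45_finite : sporadic45.Finite := by
  rw [sporadic45_eq]
  exact (List.finite_toSet _).image _

theorem image_cyclicClass_sporadic45 :
    cyclicClass '' sporadic45 = (cyclicClass ∘ toFun4) '' {p | p ∈ sporadicList45} := by
  rw [sporadic45_eq, ← Set.image_comp]
  ext C
  constructor
  · rintro ⟨p, hp, rfl⟩
    obtain ⟨q, hq, hpq⟩ := List.mem_flatMap.1 hp
    exact ⟨q, hq, (cyclicClass_eq ((toFun4_mem_cyclicClass p q).2 hpq)).symm⟩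
  · rintro ⟨q, hq, rfl⟩
    exact ⟨q, List.mem_flatMap.2 ⟨q, hq, List.mem_cons_self⟩, rfl⟩

theorem ncard_image_cyclicClass_sporadic45 : (cyclicClass '' sporadic45).ncard = 22 := by
  have h : {p | p ∈ sporadicList45} = (↑(sporadicList45.toFinset) : Set (ℕ × ℕ × ℕ × ℕ)) := by
    ext p; simp
  -- No two listed tuples are rotations of each other, so classes can be counted by representatives.
  have hrot : ∀ p ∈ sporadicList45, ∀ q ∈ sporadicList45, p ∈ rotations q → p = q := by
    decide +kernel
  rw [image_cyclicClass_sporadic45, Set.InjOn.ncard_image, h, Set.ncard_coe_finset]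
  · decide +kernel
  · intro p hp q hq hpq
    refine hrot p hp q hq ((toFun4_mem_cyclicClass p q).1 ?_)
    rw [← (show cyclicClass (toFun4 p) = cyclicClass (toFun4 q) from hpq)]
    exact mem_cyclicClass_self _

theorem isGreatest_sporadic45 : IsGreatest {e | ∃ m ∈ sporadic45, ∃ i, m i = e} 8 := by
  rw [sporadic45_eq]
  constructor
  · exact ⟨_, ⟨(8, 4, 2, 2), by decide, rfl⟩, 0, rfl⟩
  · rintro e ⟨_, ⟨p, hp, rfl⟩, i, rfl⟩
    have h := mem_sporadicList45 p hp
    fin_cases i <;> (simp [toFun4]; omega)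

/-! ### Three pointers at one target: `S44` and `S49` -/

/-- The hypothesis reads `1/a + 1/c + 1/d > 1`, and distinctness gives `1/a + 1/c ≤ 1/2 + 1/3`,
hence `1/d > 1/6`. -/
theorem le_five_of_lt {a c d : ℕ} (ha : 2 ≤ a) (hc : 2 ≤ c) (hac : a ≠ c)
    (h : a * c * d < c * d + a * d + a * c) : d ≤ 5 := by
  by_contra! hd
  obtain ⟨x, rfl⟩ := Nat.exists_eq_add_of_le' ha
  obtain ⟨y, rfl⟩ := Nat.exists_eq_add_of_le' hc
  obtain ⟨z, rfl⟩ := Nat.exists_eq_add_of_le' (Nat.succ_le_of_lt hd)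
  have hxy : 1 ≤ x + y := by omega
  simp only [Nat.succ_eq_add_one] at h
  nlinarith [Nat.zero_le (x * y), Nat.zero_le (x * y * z), mul_le_mul hxy (le_refl z)]

theorem dvd_of_mul_succ {u s : ℕ} (h : u ∣ (u + 1) * s) : u ∣ s :=
  (Nat.coprime_self_add_right.2 (Nat.coprime_one_right u)).dvd_of_dvd_mul_left h

/-- The exponents are `{2, 3, 4}` or `{2, 3, 5}`, whose pairwise products have greatest common
divisor `2` or `1`. -/
theorem not_dvd_links44 : ∀ a ∈ List.range' 2 4, ∀ c ∈ List.range' 2 4, a ≠ c →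
    ∀ d ∈ List.range' 2 4, a ≠ d → c ≠ d → a * c * d < c * d + a * d + a * c →
    ∀ u ∈ List.range 26, u ∣ a * c → u ∣ a * d → u ∣ c * d → u ∣ a ∨ u ∣ c ∨ u ∣ d := by
  decide +kernel

/-- `u` divides `(a - 1) * gcd c d`. This gcd is `1` except for `{c, d} = {2, 4}`, where `a = 3` and
`u ∣ 4`. -/
theorem not_dvd_links49 : ∀ a ∈ List.range' 2 4, ∀ c ∈ List.range' 2 4, a ≠ c →
    ∀ d ∈ List.range' 2 4, a ≠ d → c ≠ d → a * c * d < c * d + a * d + a * c →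
    ∀ u ∈ List.range 26, u ∣ (a - 1) * c → u ∣ (a - 1) * d → u ∣ a - 1 ∨ a - 1 ∣ u := by
  decide +kernel

theorem S44_irreducibleExponents : S44.irreducibleExponents = ∅ := by
  rw [Set.eq_empty_iff_forall_notMem]
  intro m hm
  rw [eq_vec4 m, mem_S44] at hm
  generalize m 0 = a at hm
  generalize m 1 = b at hm
  generalize m 2 = c at hm
  generalize m 3 = d at hm
  obtain ⟨ha, hb, hc, hd, ⟨x, y, hxy⟩, ⟨x', y', hxy'⟩, ⟨x'', y'', hxy''⟩, h0, h2, h3, hlt⟩ := hm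
  obtain ⟨u, rfl⟩ := Nat.exists_eq_add_of_le' (show 1 ≤ b by omega)
  simp only [Nat.add_sub_cancel] at *
  have hu : 2 ≤ u := by omega
  -- Pointers with equal exponents at one target have equal charges, so a link between them is a
  -- pure power and gives reducibility.
  have hac : a ≠ c := by
    rintro rfl
    exact h0 ⟨x + y, by rw [← hxy]; ring⟩
  have had : a ≠ d := by
    rintro rfl
    exact h0 ⟨x' + y', by rw [← hxy']; ring⟩
  have hcd : c ≠ d := by
    rintro rfl
    exact h2 ⟨x'' + y'', by rw [← hxy'']; ring⟩
  have hlt' : a * c * d < c * d + a * d + a * c := by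
    have : u * (a * c * d) < u * (c * d + a * d + a * c) := by linarith
    exact lt_of_mul_lt_mul_left this (by omega)
  have hua : ¬ u ∣ a := fun ⟨t, ht⟩ => h0 ⟨t * (u + 1), by rw [ht]; ring⟩
  have huc : ¬ u ∣ c := fun ⟨t, ht⟩ => h2 ⟨t * (u + 1), by rw [ht]; ring⟩
  have hud : ¬ u ∣ d := fun ⟨t, ht⟩ => h3 ⟨t * (u + 1), by rw [ht]; ring⟩
  have l1 : u ∣ a * c := by
    refine dvd_of_mul_succ ⟨x * c + y * a, ?_⟩
    refine Nat.eq_of_mul_eq_mul_right (show 0 < d by omega) ?_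
    linarith
  have l2 : u ∣ a * d := by
    refine dvd_of_mul_succ ⟨x' * d + y' * a, ?_⟩
    refine Nat.eq_of_mul_eq_mul_right (show 0 < c by omega) ?_
    linarith
  have l3 : u ∣ c * d := by
    refine dvd_of_mul_succ ⟨x'' * d + y'' * c, ?_⟩
    refine Nat.eq_of_mul_eq_mul_right (show 0 < a by omega) ?_
    linarith
  have hd5 := le_five_of_lt ha hc hac hlt'
  have ha5 : a ≤ 5 := le_five_of_lt hc hd hcd (by linarith)
  have hc5 : c ≤ 5 := le_five_of_lt ha hd had (by linarith)
  have hu25 : u ≤ 5 * 5 :=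
    (Nat.le_of_dvd (Nat.mul_pos (by omega) (by omega)) l1).trans (Nat.mul_le_mul ha5 hc5)
  have := not_dvd_links44 a (List.mem_range'_1.2 (by omega)) c (List.mem_range'_1.2 (by omega)) hac
    d (List.mem_range'_1.2 (by omega)) had hcd hlt' u (List.mem_range.2 (by omega)) l1 l2 l3
  tauto

/-- In a two-cycle with exponents `a = v + 1` and `b = u + 1`, a link between the second node of
the cycle and another pointer with exponent `c` at the same target constrains the exponents. -/
theorem dvd_of_link {u v c d x y : ℕ} (hd : 0 < d)
    (h : x * (u * c * d) + y * ((v + 1) * u * d) = ((v + 1) * (u + 1) - 1) * c * d) :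
    u ∣ v * c := by
  have e : (v + 1) * (u + 1) - 1 = u * (v + 1) + v := Nat.sub_eq_of_eq_add (by ring)
  rw [e] at h
  -- Modulo `u` only `v * c` survives on the right.
  have h' : u * (x * c + y * (v + 1)) = u * ((v + 1) * c) + v * c := by
    refine Nat.eq_of_mul_eq_mul_right hd ?_
    linarith
  exact (Nat.dvd_add_right (Dvd.intro _ rfl)).1 (h' ▸ Dvd.intro _ rfl)

theorem S49_irreducibleExponents : S49.irreducibleExponents = ∅ := by
  rw [Set.eq_empty_iff_forall_notMem]
  intro m hm
  rw [eq_vec4 m, mem_S49] at hm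
  generalize m 0 = a at hm
  generalize m 1 = b at hm
  generalize m 2 = c at hm
  generalize m 3 = d at hm
  obtain ⟨ha, hb, hc, hd, ⟨x, y, hxy⟩, ⟨x', y', hxy'⟩, ⟨x'', y'', hxy''⟩, h0, h1, h2, -, hlt⟩ := hm
  obtain ⟨u, rfl⟩ := Nat.exists_eq_add_of_le' (show 1 ≤ b by omega)
  obtain ⟨v, rfl⟩ := Nat.exists_eq_add_of_le' (show 1 ≤ a by omega)
  simp only [Nat.add_sub_cancel] at *
  have hac : v + 1 ≠ c := by
    rintro rfl
    exact h0 ⟨x + y, by rw [← hxy]; ring⟩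
  have had : v + 1 ≠ d := by
    rintro rfl
    exact h0 ⟨x' + y', by rw [← hxy']; ring⟩
  have hcd : c ≠ d := by
    rintro rfl
    exact h2 ⟨x'' + y'', by rw [← hxy'']; ring⟩
  have l1 : u ∣ v * c := dvd_of_link (by omega) hxy
  have l2 : u ∣ v * d := by
    refine dvd_of_link (c := d) (d := c) (x := x') (y := y') (by omega) ?_
    linarith
  have e : (v + 1) * (u + 1) - 1 = u * (v + 1) + v := Nat.sub_eq_of_eq_add (by ring)
  rw [e] at h0 h1 hlt
  -- The three pointers have charges `(1 - q) / a`, `(1 - q) / c`, `(1 - q) / d` with `q` the charge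
  -- of their target, so `c < 6` does not depend on `b`.
  have hlt' : (v + 1) * c * d < c * d + (v + 1) * d + (v + 1) * c := by
    have : u * ((v + 1) * c * d) < u * (c * d + (v + 1) * d + (v + 1) * c) := by linarith
    exact lt_of_mul_lt_mul_left this (by omega)
  have huv : ¬ u ∣ v := fun ⟨t, ht⟩ => h0 ⟨v + 1 + t, by rw [ht]; ring⟩
  have hvu : ¬ v ∣ u := fun ⟨t, ht⟩ => h1 ⟨u + t + 1, by rw [ht]; ring⟩
  have hd5 := le_five_of_lt ha hc hac hlt'
  have ha5 : v + 1 ≤ 5 := le_five_of_lt hc hd hcd (by linarith)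
  have hc5 : c ≤ 5 := le_five_of_lt ha hd had (by linarith)
  have hu25 : u ≤ 4 * 5 :=
    (Nat.le_of_dvd (Nat.mul_pos (by omega) (by omega)) l1).trans (Nat.mul_le_mul (by omega) hc5)
  have := not_dvd_links49 (v + 1) (List.mem_range'_1.2 (by omega)) c
    (List.mem_range'_1.2 (by omega)) hac d (List.mem_range'_1.2 (by omega)) had hcd hlt' u
    (List.mem_range.2 (by omega)) l1 l2
  tauto

/-! ### Two-cycles with further pointers: `S48` and `S46` -/

/-- What remains of the region `c < 6` on `S48` below the truncation. -/
def Remains48 (a b c d : ℕ) : Prop :=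
  a = 2 ∨ b = 2 ∨ (c = 2 ∧ d = 2) ∨ (a < 10 ∧ a = c) ∨ (b < 10 ∧ b = d) ∨
    (a < 10 ∧ b < 10 ∧ (b - 1 ∣ a - 1 ∨ a - 1 ∣ b - 1)) ∨
    (a < 10 ∧ c < 10 ∧ ((a - 1) * c < b - 1 ∨ (b < 10 ∧ ¬ b - 1 ∣ (a - 1) * c))) ∨
    (b < 10 ∧ d < 10 ∧ ((b - 1) * d < a - 1 ∨ (a < 10 ∧ ¬ a - 1 ∣ (b - 1) * d)))

instance (a b c d : ℕ) : Decidable (Remains48 a b c d) := by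
  unfold Remains48
  infer_instance

theorem remains48 : ∀ a ∈ List.range' 2 9, Low48 a 2 2 2 → ∀ b ∈ List.range' 2 9,
    Low48 a b 2 2 → ∀ c ∈ List.range' 2 9, Low48 a b c 2 → ∀ d ∈ List.range' 2 9,
    Low48 a b c d → Remains48 a b c d := by
  decide +kernel

theorem S48_irreducibleExponents : S48.irreducibleExponents = ∅ := by
  rw [Set.eq_empty_iff_forall_notMem]
  intro m hm
  rw [eq_vec4 m, mem_S48] at hm
  generalize m 0 = a at hm
  generalize m 1 = b at hm
  generalize m 2 = c at hm
  generalize m 3 = d at hm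
  obtain ⟨ha, hb, hc, hd, ⟨x, y, hxy⟩, ⟨x', y', hxy'⟩, h0, h1, -, -, hlt⟩ := hm
  obtain ⟨u, rfl⟩ := Nat.exists_eq_add_of_le' (show 1 ≤ b by omega)
  obtain ⟨v, rfl⟩ := Nat.exists_eq_add_of_le' (show 1 ≤ a by omega)
  simp only [Nat.add_sub_cancel] at *
  have hac : v + 1 ≠ c := by
    rintro rfl
    exact h0 ⟨x + y, by rw [← hxy]; ring⟩
  have hbd : u + 1 ≠ d := by
    rintro rfl
    exact h1 ⟨x' + y', by rw [← hxy']; ring⟩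
  have l1 : u ∣ v * c := dvd_of_link (by omega) hxy
  have l2 : v ∣ u * d := by
    refine dvd_of_link (d := c) (x := x') (y := y') (by omega) ?_
    rw [mul_comm (u + 1) (v + 1)]
    linarith
  have e : (v + 1) * (u + 1) - 1 = u * (v + 1) + v := Nat.sub_eq_of_eq_add (by ring)
  rw [e] at h0 h1 hlt
  have huv : ¬ u ∣ v := fun ⟨t, ht⟩ => h0 ⟨v + 1 + t, by rw [ht]; ring⟩
  have hvu : ¬ v ∣ u := fun ⟨t, ht⟩ => h1 ⟨u + t + 1, by rw [ht]; ring⟩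
  have hlow : Low48 (v + 1) (u + 1) c d := by
    unfold Low48
    linarith
  -- Here `c < 6` bounds neither `a` nor `b`. The links give `2v = us` and `2u = vt`, so `st = 4`,
  -- and each factorization makes one of `u`, `v` divide the other.
  have hcd : ¬ (c = 2 ∧ d = 2) := by
    rintro ⟨rfl, rfl⟩
    obtain ⟨s, hs⟩ := l1
    obtain ⟨t, ht⟩ := l2
    have hst : s * t = 4 := by
      refine Nat.eq_of_mul_eq_mul_left (show 0 < u by omega) ?_
      refine Nat.eq_of_mul_eq_mul_left (show 0 < v by omega) ?_
      calc v * (u * (s * t)) = u * s * (v * t) := by ring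
        _ = v * 2 * (u * 2) := by rw [hs, ht]
        _ = v * (u * 4) := by ring
    have hs4 : s ∣ 4 := ⟨t, hst.symm⟩
    have : s ≤ 4 := Nat.le_of_dvd (by norm_num) hs4
    interval_cases s
    · omega
    · exact hvu ⟨2, by omega⟩
    · exact hvu ⟨1, by omega⟩
    · omega
    · exact huv ⟨2, by omega⟩
  have hr := downClosed_low48.truncate (F := Remains48) 10 (by norm_num) remains48
      ha hb hc hd hlow
  have e : ∀ x, min x 10 < 10 → min x 10 = x := by omega
  rcases hr with h | h | h | ⟨ha', h⟩ | ⟨hb', h⟩ | ⟨ha', hb', h⟩ | ⟨ha', hc', h⟩ | ⟨hb', hd', h⟩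
  · have : v = 1 := by omega
    exact hvu (this ▸ one_dvd u)
  · have : u = 1 := by omega
    exact huv (this ▸ one_dvd v)
  · omega
  · omega
  · omega
  · rw [e _ ha', e _ hb'] at h
    tauto
  · rw [e _ ha', e _ hc'] at h
    -- The inequality bounds the truncated `b` from below, hence also `b` itself, so it makes `u`
    -- too large to divide `v * c`.
    rcases h with h | ⟨hb', h⟩
    · have := Nat.le_of_dvd (Nat.mul_pos (by omega) (by omega)) l1
      simp only [Nat.add_sub_cancel] at h
      omega
    · rw [e _ hb'] at h
      exact h l1
  · rw [e _ hb', e _ hd'] at h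
    rcases h with h | ⟨ha', h⟩
    · have := Nat.le_of_dvd (Nat.mul_pos (by omega) (by omega)) l2
      simp only [Nat.add_sub_cancel] at h
      omega
    · rw [e _ ha'] at h
      exact h l2

/-- What remains of the region `c < 6` on `S46` below the truncation. -/
def Remains46 (a b c d : ℕ) : Prop :=
  a = 2 ∨ b = 2 ∨ (b = 3 ∧ c = 2) ∨ (a < 10 ∧ a = c) ∨
    (a < 10 ∧ b < 10 ∧ (b - 1 ∣ a - 1 ∨ a - 1 ∣ b - 1)) ∨
    (a < 10 ∧ c < 10 ∧ ((a - 1) * c < b - 1 ∨ (b < 10 ∧ ¬ b - 1 ∣ (a - 1) * c))) ∨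
    (a = 3 ∧ b = 4 ∧ c = 6 ∧ d = 2) ∨ (a = 4 ∧ b = 3 ∧ c = 6 ∧ d = 2)

instance (a b c d : ℕ) : Decidable (Remains46 a b c d) := by
  unfold Remains46
  infer_instance

theorem remains46 : ∀ a ∈ List.range' 2 9, Low46 a 2 2 2 → ∀ b ∈ List.range' 2 9,
    Low46 a b 2 2 → ∀ c ∈ List.range' 2 9, Low46 a b c 2 → ∀ d ∈ List.range' 2 9,
    Low46 a b c d → Remains46 a b c d := by
  decide +kernel

theorem S46_irreducibleExponents : S46.irreducibleExponents = ∅ := by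
  rw [Set.eq_empty_iff_forall_notMem]
  intro m hm
  rw [eq_vec4 m, mem_S46] at hm
  generalize m 0 = a at hm
  generalize m 1 = b at hm
  generalize m 2 = c at hm
  generalize m 3 = d at hm
  obtain ⟨ha, hb, hc, hd, ⟨x, y, hxy⟩, h0, h1, -, -, hlt⟩ := hm
  obtain ⟨u, rfl⟩ := Nat.exists_eq_add_of_le' (show 1 ≤ b by omega)
  obtain ⟨v, rfl⟩ := Nat.exists_eq_add_of_le' (show 1 ≤ a by omega)
  simp only [Nat.add_sub_cancel] at *
  have hac : v + 1 ≠ c := by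
    rintro rfl
    exact h0 ⟨x + y, by rw [← hxy]; ring⟩
  have l1 : u ∣ v * c := dvd_of_link (by omega) hxy
  have e : (v + 1) * (u + 1) - 1 = u * (v + 1) + v := Nat.sub_eq_of_eq_add (by ring)
  rw [e] at hxy h0 h1 hlt
  have hlink : u * (x * c + y * (v + 1)) = (u * (v + 1) + v) * c := by
    refine Nat.eq_of_mul_eq_mul_right (show 0 < d by omega) ?_
    linarith
  have huv : ¬ u ∣ v := fun ⟨t, ht⟩ => h0 ⟨v + 1 + t, by rw [ht]; ring⟩
  have hvu : ¬ v ∣ u := fun ⟨t, ht⟩ => h1 ⟨u + t + 1, by rw [ht]; ring⟩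
  have hlow : Low46 (v + 1) (u + 1) c d := by
    obtain ⟨z, rfl⟩ := Nat.exists_eq_add_of_le' hc
    have e : (u * (v + 1) + v) * (z + 2) - (v + 1) * u =
        u * (v + 1) * (z + 1) + v * (z + 2) := Nat.sub_eq_of_eq_add (by ring)
    rw [e] at hlt
    unfold Low46
    linarith
  have hr := downClosed_low46.truncate (F := Remains46) 10 (by norm_num) remains46
      ha hb hc hd hlow
  have e : ∀ x, min x 10 < 10 → min x 10 = x := by omega
  have e' : ∀ x j, j < 10 → min x 10 = j → x = j := by omega
  rcases hr with h | h | ⟨hb', hc'⟩ | ⟨ha', h⟩ | ⟨ha', hb', h⟩ | ⟨ha', hc', h⟩ |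
    ⟨ha', hb', hc', -⟩ | ⟨ha', hb', hc', -⟩
  · have : v = 1 := by omega
    exact hvu (this ▸ one_dvd u)
  · have : u = 1 := by omega
    exact huv (this ▸ one_dvd v)
  · obtain rfl : u = 2 := by omega
    obtain rfl : c = 2 := by omega
    obtain ⟨w, rfl⟩ : ∃ w, v = 2 * w + 1 := ⟨v / 2, by omega⟩
    -- `c < 6` leaves `a` unbounded when `d = 2`; the link equation fails by parity.
    have : 2 * x + 2 * (y * (w + 1)) = 6 * w + 5 := by linarith
    omega
  · omega
  · rw [e _ ha', e _ hb'] at h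
    tauto
  · rw [e _ ha', e _ hc'] at h
    rcases h with h | ⟨hb', h⟩
    · have := Nat.le_of_dvd (Nat.mul_pos (by omega) (by omega)) l1
      simp only [Nat.add_sub_cancel] at h
      omega
    · rw [e _ hb'] at h
      exact h l1
  -- The two remaining tuples pass `u ∣ v * c`, but their link equations are `6x + 3y = 22` and `6x
  -- + 4y = 33`.
  · obtain rfl : v = 2 := by omega
    obtain rfl : u = 3 := by omega
    obtain rfl : c = 6 := by omega
    omega
  · obtain rfl : v = 3 := by omega
    obtain rfl : u = 2 := by omega
    obtain rfl : c = 6 := by omega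
    omega

/-! ### The skeleton `S43` -/

/-- What remains of the region `c < 6` on `S43` below the truncation. -/
def Remains43 (a b c d : ℕ) : Prop :=
  c < 3 ∨ (a < 11 ∧ a = d) ∨ (b < 11 ∧ c < 11 ∧ c - 1 ∣ b) ∨
    (a < 11 ∧ b < 11 ∧ c < 11 ∧
      ((b - 1) * c + 1 ∣ a * b * c ∨ Nat.Coprime ((b - 1) * c + 1) (a * (c - 1)))) ∨
    (d < 11 ∧ b < 11 ∧ c < 11 ∧
      ((b - 1) * c + 1 ∣ d * b * c ∨ Nat.Coprime ((b - 1) * c + 1) (d * (c - 1)))) ∨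
    (a < 11 ∧ c < 11 ∧ d < 11 ∧ (a * d * (c - 1) < (b - 1) * c + 1 ∨
      (b < 11 ∧ ¬ (b - 1) * c + 1 ∣ a * d * (c - 1))))

instance (a b c d : ℕ) : Decidable (Remains43 a b c d) := by
  unfold Remains43
  infer_instance

theorem remains43 : ∀ a ∈ List.range' 2 10, Low43 a 2 2 2 → ∀ b ∈ List.range' 2 10,
    Low43 a b 2 2 → ∀ c ∈ List.range' 2 10, Low43 a b c 2 → ∀ d ∈ List.range' 2 10,
    Low43 a b c d → Remains43 a b c d := by
  decide +kernel

theorem S43_irreducibleExponents : S43.irreducibleExponents = ∅ := by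
  rw [Set.eq_empty_iff_forall_notMem]
  intro m hm
  rw [eq_vec4 m, mem_S43] at hm
  generalize m 0 = a at hm
  generalize m 1 = b at hm
  generalize m 2 = c at hm
  generalize m 3 = d at hm
  obtain ⟨ha, hb, hc, hd, ⟨x, y, hxy⟩, h0, h1, h3, hlt⟩ := hm
  have had : a ≠ d := by
    rintro rfl
    exact h0 ⟨x + y, by rw [← hxy]; ring⟩
  have hbc : b * c = ((b - 1) * c + 1) + (c - 1) := by
    obtain ⟨u, rfl⟩ := Nat.exists_eq_add_of_le' (show 1 ≤ b by omega)
    obtain ⟨v, rfl⟩ := Nat.exists_eq_add_of_le' (show 1 ≤ c by omega)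
    simp only [Nat.add_sub_cancel]
    ring
  have hlow : Low43 a b c d := by
    obtain ⟨u, rfl⟩ := Nat.exists_eq_add_of_le' (show 1 ≤ b by omega)
    obtain ⟨v, rfl⟩ := Nat.exists_eq_add_of_le' (show 1 ≤ c by omega)
    simp only [Nat.add_sub_cancel] at hlt
    unfold Low43
    linarith
  have hr := downClosed_low43.truncate (F := Remains43) 11 (by norm_num) remains43
    ha hb (by omega) hd hlow
  have e : ∀ x, min x 11 < 11 → min x 11 = x := by omega
  have hle : (min b 11 - 1) * c + 1 ≤ (b - 1) * c + 1 := by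
    have : min b 11 - 1 ≤ b - 1 := by omega
    gcongr
  set P := (b - 1) * c + 1
  -- The link gives `P ∣ a * d * (b * c)`, and `b * c` is `c - 1` modulo `P`.
  have l1 : P ∣ a * d * (c - 1) := by
    have h : a * d * P + a * d * (c - 1) = P * (x * d + y * a) := by
      calc a * d * P + a * d * (c - 1) = a * d * (b * c) := by rw [hbc]; ring
        _ = a * b * c * d := by ring
        _ = P * (x * d + y * a) := by rw [← hxy]; ring
    exact (Nat.dvd_add_right (Dvd.intro_left _ rfl)).1 (h ▸ Dvd.intro _ rfl)
  have ha0 : ¬ P ∣ a * b * c := fun ⟨t, ht⟩ => h0 ⟨t, by rw [ht]; ring⟩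
  have hd0 : ¬ P ∣ d * b * c := fun ⟨t, ht⟩ =>
    h3 ⟨t, by rw [show a * b * c * d = a * (d * b * c) by ring, ht]; ring⟩
  rcases hr with h | ⟨ha', h⟩ | ⟨hb', hc', h⟩ | ⟨ha', hb', hc', h⟩ | ⟨hd', hb', hc', h⟩ |
    ⟨ha', hc', hd', h⟩
  · omega
  · omega
  · rw [e _ hb', e _ hc'] at h
    obtain ⟨t, ht⟩ := h
    exact h1 ⟨t * c, by rw [ht]; ring⟩
  · rw [e _ ha', e _ hb', e _ hc'] at h
    rcases h with h | h
    · exact ha0 h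
    -- Coprimality to `a * (c - 1)` pushes `P` into `d`, so the charge of the fourth node is the
    -- inverse of an integer.
    · have : P ∣ d := h.dvd_of_dvd_mul_left (by convert l1 using 1; ring)
      exact hd0 (mul_assoc d b c ▸ this.mul_right (b * c))
  · rw [e _ hd', e _ hb', e _ hc'] at h
    rcases h with h | h
    · exact hd0 h
    · have : P ∣ a := h.dvd_of_dvd_mul_left (by convert l1 using 1; ring)
      exact ha0 (mul_assoc a b c ▸ this.mul_right (b * c))
  · rw [e _ ha', e _ hc', e _ hd'] at h
    rcases h with h | ⟨hb', h⟩
    · have hpos : 0 < a * d * (c - 1) :=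
        Nat.mul_pos (Nat.mul_pos (by omega) (by omega)) (by omega)
      exact absurd (Nat.le_of_dvd hpos l1) (by omega)
    · rw [e _ hb'] at h
      exact h l1

/-! ### The skeleton `S42` -/

/-- What remains of the region `c < 6` on `S42` below the truncation. -/
def Remains42 (a b c d : ℕ) : Prop :=
  b < 3 ∨ (a = 2 ∧ d = 2) ∨ (a < 14 ∧ a = c) ∨
    (a < 14 ∧ b < 14 ∧ (b - 1 ∣ a ∨ Nat.Coprime (b - 1) a)) ∨
    (b < 14 ∧ c < 14 ∧ (b - 1 ∣ c ∨ Nat.Coprime (b - 1) c)) ∨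
    (a < 14 ∧ c < 14 ∧ (a * c < b - 1 ∨ (b < 14 ∧ ¬ b - 1 ∣ a * c))) ∨
    (a, b, c, d) ∈ [(2, 7, 3, 3), (2, 7, 3, 4), (3, 7, 2, 2), (3, 7, 2, 3), (3, 7, 4, 2)] ∨
    (a, b, c) ∈ [(2, 5, 6), (2, 9, 4), (4, 9, 2), (6, 5, 2)]

instance (a b c d : ℕ) : Decidable (Remains42 a b c d) := by
  unfold Remains42
  infer_instance

theorem remains42 : ∀ a ∈ List.range' 2 13, Low42 a 2 2 2 → ∀ b ∈ List.range' 2 13,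
    Low42 a b 2 2 → ∀ c ∈ List.range' 2 13, Low42 a b c 2 → ∀ d ∈ List.range' 2 13,
    Low42 a b c d → Remains42 a b c d := by
  decide +kernel

theorem isCharges_S42 (a b c d : ℕ) (p q r s : ℚ) : S42.IsCharges ![a, b, c, d] ![p, q, r, s] ↔
    a * p + q = 1 ∧ b * q = 1 ∧ c * r + q = 1 ∧ d * s + r = 1 := by
  simp [Skeleton.IsCharges, Skeleton.targetCharge, S42, Fin.forall_fin_succ]

theorem realized_family42 (k l : ℕ) : Realized S42 (family42 k l) := by
  intro _
  simp only [family42]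
  rw [isCharges_S42, centralCharge_vec4_lt]
  have hk : (0 : ℚ) < 4 * k + 3 := by positivity
  have hk' : (0 : ℚ) < 2 * k + 1 := by positivity
  have hl : (0 : ℚ) < 2 * l + 1 := by positivity
  refine ⟨⟨?_, ?_, ?_, ?_⟩, ?_⟩
  · field_simp; push_cast; ring
  · field_simp; push_cast; ring
  · field_simp; push_cast; field_simp; ring
  · field_simp; push_cast; ring
  · rw [← sub_pos]
    field_simp
    ring_nf
    positivity

theorem family42_mem (k l : ℕ) (hk : 1 ≤ k) : (family42 k l).1 ∈ S42.irreducibleExponents := by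
  simp only [family42]
  set c := (2 * l + 1) * (2 * k + 1) with hc
  have hc3 : 3 ≤ c := by nlinarith
  rw [mem_S42]
  have e : 4 * k + 3 - 1 = 4 * k + 2 := rfl
  rw [e]
  -- With `x = 1` the link equation reduces to `2y(2k + 1) = (2k + 2)c`, which determines `y`.
  refine ⟨le_rfl, by omega, by omega, le_rfl, ⟨1, (2 * l + 1) * (k + 1), ?_⟩, ?_, ?_, ?_, ?_⟩
  · rw [hc]
    ring
  · refine Nat.not_dvd_of_lt_of_lt_mul_succ (k := 2) ?_ ?_ <;> nlinarith
  · rintro ⟨t, ht⟩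
    have h : (4 * k + 3) * c = 2 * ((2 * k + 1) * t) := by linarith
    have ho : Odd ((4 * k + 3) * c) :=
      Odd.mul ⟨2 * k + 1, by ring⟩ (Odd.mul ⟨l, rfl⟩ ⟨k, rfl⟩)
    exact (Nat.not_even_iff_odd.2 ho) (h ▸ even_two_mul _)
  · obtain ⟨z, hz⟩ := Nat.exists_eq_add_of_le' hc3
    rw [hz]
    simp only [Nat.add_succ_sub_one]
    refine Nat.not_dvd_of_lt_of_lt_mul_succ (k := 2) ?_ ?_ <;> nlinarith
  · obtain ⟨z, hz⟩ := Nat.exists_eq_add_of_le' hc3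
    rw [hz]
    simp only [Nat.add_succ_sub_one]
    nlinarith

/-- The link forces `2c = ut`, and `t` is odd because `u ∤ c`. Then `xc + 2y = 2c + t` is odd, so
`c` is odd; hence `u = 2w` and `c = wt` with `w`, `t` both odd, which is the parametrization of the
family. -/
theorem exists_family42 {u c x y : ℕ} (hu : 2 ≤ u) (hc : 2 ≤ c)
    (hxy : u * (x * c + 2 * y) = 2 * (u + 1) * c) (h2 : ¬ u ∣ 2) (hcu : ¬ u ∣ c) :
    ∃ k l, 1 ≤ k ∧ u + 1 = 4 * k + 3 ∧ c = (2 * l + 1) * (2 * k + 1) := by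
  obtain ⟨t, ht⟩ : u ∣ 2 * c := by
    refine dvd_of_mul_succ ⟨x * c + 2 * y, ?_⟩
    rw [hxy]
    ring
  have hu3 : 3 ≤ u := by
    rcases hu.lt_or_eq with h | rfl
    · exact h
    · exact absurd dvd_rfl h2
  have htodd : t % 2 = 1 := by
    by_contra h
    obtain ⟨s, rfl⟩ : ∃ s, t = 2 * s := ⟨t / 2, by omega⟩
    exact hcu ⟨s, by linarith⟩
  have hsum : x * c + 2 * y = 2 * c + t := by
    refine Nat.eq_of_mul_eq_mul_left (show 0 < u by omega) ?_
    linarith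
  have htc : t < c := by
    have : 3 * t ≤ u * t := Nat.mul_le_mul_right t hu3
    omega
  have hx3 : x < 3 := by
    by_contra! h
    have : 3 * c ≤ x * c := Nat.mul_le_mul_right c h
    omega
  -- The bound on `x` serves to make the parity argument linear.
  have hcodd : c % 2 = 1 := by
    interval_cases x <;> omega
  obtain ⟨w, rfl⟩ : ∃ w, u = 2 * w := by
    have h : Even (u * t) := ht ▸ even_two_mul c
    rcases Nat.even_mul.1 h with h | h
    · obtain ⟨w, hw⟩ := h
      exact ⟨w, by omega⟩
    · exact absurd (Nat.even_iff.1 h) (by omega)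
  have hcwt : c = w * t := by linarith
  have hw : w % 2 = 1 := by
    have h : Odd (w * t) := hcwt ▸ Nat.odd_iff.2 hcodd
    exact Nat.odd_iff.1 (Nat.odd_mul.1 h).1
  obtain ⟨k, rfl⟩ : ∃ k, w = 2 * k + 1 := ⟨w / 2, by omega⟩
  obtain ⟨l, rfl⟩ : ∃ l, t = 2 * l + 1 := ⟨t / 2, by omega⟩
  exact ⟨k, l, by omega, by omega, by rw [hcwt]; ring⟩

theorem S42_irreducibleExponents : S42.irreducibleExponents =
    {m | ∃ k l, 1 ≤ k ∧ m = (family42 k l).1} ∪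
      {![2, 7, 3, 3], ![2, 7, 3, 4], ![3, 7, 2, 2], ![3, 7, 2, 3], ![3, 7, 4, 2]} := by
  ext m
  constructor
  · intro hm
    rw [eq_vec4 m] at hm ⊢
    rw [mem_S42] at hm
    generalize m 0 = a at hm ⊢
    generalize m 1 = b at hm ⊢
    generalize m 2 = c at hm ⊢
    generalize m 3 = d at hm ⊢
    obtain ⟨ha, hb, hc, hd, ⟨x, y, hxy⟩, h0, h2, -, hlt⟩ := hm
    obtain ⟨u, rfl⟩ := Nat.exists_eq_add_of_le' (show 1 ≤ b by omega)
    simp only [Nat.add_sub_cancel] at hxy h0 h2 hlt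
    have hu : 2 ≤ u := by omega
    have hac : a ≠ c := by
      rintro rfl
      exact h0 ⟨x + y, by rw [← hxy]; ring⟩
    have hlow : Low42 a (u + 1) c d := by
      obtain ⟨v, rfl⟩ := Nat.exists_eq_add_of_le' (show 1 ≤ c by omega)
      simp only [Nat.add_sub_cancel] at hlt
      unfold Low42
      linarith
    have hua : ¬ u ∣ a := fun ⟨t, ht⟩ => h0 ⟨t * (u + 1), by rw [ht]; ring⟩
    have huc : ¬ u ∣ c := fun ⟨t, ht⟩ => h2 ⟨t * (u + 1), by rw [ht]; ring⟩
    have hlink : u * (x * c + y * a) = a * (u + 1) * c := by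
      refine Nat.eq_of_mul_eq_mul_right (show 0 < d by omega) ?_
      linarith
    have l1 : u ∣ a * c := dvd_of_mul_succ ⟨x * c + y * a, by rw [hlink]; ring⟩
    have hr := downClosed_low42.truncate (F := Remains42) 14 (by norm_num) remains42
      ha (by omega) hc hd hlow
    have e : ∀ x, min x 14 < 14 → min x 14 = x := by omega
    have e' : ∀ x j, j < 14 → (min x 14 = j ↔ x = j) := by omega
    rcases hr with h | ⟨ha', hd'⟩ | ⟨ha', h⟩ | ⟨ha', hb', h⟩ | ⟨hb', hc', h⟩ | ⟨ha', hc', h⟩ | h | h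
    · omega
    -- With `a = d = 2` the condition `c < 6` always holds, so the link alone decides.
    · obtain rfl : a = 2 := by omega
      obtain rfl : d = 2 := by omega
      left
      obtain ⟨k, l, hk, hu', hc'⟩ := exists_family42 (x := x) (y := y) hu hc (by linarith) hua huc
      exact ⟨k, l, hk, by rw [hu', hc']; rfl⟩
    · omega
    · rw [e _ ha', e _ hb', Nat.add_sub_cancel] at h
      rcases h with h | h
      · exact absurd h hua
      · exact absurd (h.dvd_of_dvd_mul_left l1) huc
    · rw [e _ hb', e _ hc', Nat.add_sub_cancel] at h
      rcases h with h | h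
      · exact absurd h huc
      · exact absurd (h.dvd_of_dvd_mul_right l1) hua
    · rw [e _ ha', e _ hc'] at h
      rcases h with h | ⟨hb', h⟩
      · have := Nat.le_of_dvd (Nat.mul_pos (by omega) (by omega)) l1
        omega
      · rw [e _ hb'] at h
        exact absurd l1 h
    · right
      simp only [List.mem_cons, Prod.mk.injEq, List.not_mem_nil, or_false, e' _ 2 (by norm_num),
        e' _ 3 (by norm_num), e' _ 4 (by norm_num), e' _ 7 (by norm_num)] at h
      rcases h with ⟨rfl, h', rfl, rfl⟩ | ⟨rfl, h', rfl, rfl⟩ | ⟨rfl, h', rfl, rfl⟩ |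
        ⟨rfl, h', rfl, rfl⟩ | ⟨rfl, h', rfl, rfl⟩ <;> rw [h'] <;> simp
    -- These triples satisfy `u ∣ a * c`, but their link equations equate an even number with `15`
    -- or `9`.
    · exfalso
      simp only [List.mem_cons, Prod.mk.injEq, List.not_mem_nil, or_false, e' _ 2 (by norm_num),
        e' _ 4 (by norm_num), e' _ 5 (by norm_num), e' _ 6 (by norm_num),
        e' _ 9 (by norm_num)] at h
      rcases h with ⟨rfl, h', rfl⟩ | ⟨rfl, h', rfl⟩ | ⟨rfl, h', rfl⟩ | ⟨rfl, h', rfl⟩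
      · obtain rfl : u = 4 := by omega
        omega
      · obtain rfl : u = 8 := by omega
        omega
      · obtain rfl : u = 8 := by omega
        omega
      · obtain rfl : u = 4 := by omega
        omega
  · rintro (⟨k, l, hk, rfl⟩ | rfl | rfl | rfl | rfl | rfl)
    · exact family42_mem k l hk
    all_goals rw [mem_S42]
    · exact ⟨by decide, by decide, by decide, by decide, ⟨1, 2, by decide⟩, by decide, by decide,
        by decide, by decide⟩
    · exact ⟨by decide, by decide, by decide, by decide, ⟨1, 2, by decide⟩, by decide, by decide,
        by decide, by decide⟩
    · exact ⟨by decide, by decide, by decide, by decide, ⟨2, 1, by decide⟩, by decide, by decide,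
        by decide, by decide⟩
    · exact ⟨by decide, by decide, by decide, by decide, ⟨2, 1, by decide⟩, by decide, by decide,
        by decide, by decide⟩
    · exact ⟨by decide, by decide, by decide, by decide, ⟨2, 2, by decide⟩, by decide, by decide,
        by decide, by decide⟩

/-! ### The three-cycle with a pointer, `S47` -/

/-- What remains of the region `c < 6` on `S47` below the truncation. -/
def Remains47 (a b c d : ℕ) : Prop :=
  (c < 10 ∧ c = d) ∨ (a = 2 ∧ b = 2 ∧ d = 3) ∨ (b = 2 ∧ d = 2) ∨
    (a < 10 ∧ b < 10 ∧ d < 10 ∧ (Nat.Coprime ((a - 1) * b + 1) d ∨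
      ¬ Nat.gcd (d * (b - 1)) ((a - 1) * b + 1) ∣ d)) ∨
    (a < 10 ∧ b < 10 ∧ c < 10 ∧ ((b - 1) * c + 1 ∣ a * b * c + 1 ∨
      (c - 1) * a + 1 ∣ a * b * c + 1 ∨ (a - 1) * b + 1 ∣ a * b * c + 1)) ∨
    (b < 10 ∧ c < 10 ∧ d < 10 ∧ (d * ((b - 1) * c + 1) < (a - 1) * b + 1 ∨
      (a < 10 ∧ ¬ (a - 1) * b + 1 ∣ d * ((b - 1) * c + 1)))) ∨
    (a = 2 ∧ b = 2 ∧ c = 3 ∧ d = 6) ∨ (a = 2 ∧ b = 3 ∧ c = 2 ∧ d = 4) ∨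
    (a = 3 ∧ b = 2 ∧ c = 2 ∧ d = 5)

instance (a b c d : ℕ) : Decidable (Remains47 a b c d) := by
  unfold Remains47
  infer_instance

theorem remains47 : ∀ a ∈ List.range' 2 9, Low47 a 2 2 2 → ∀ b ∈ List.range' 2 9,
    Low47 a b 2 2 → ∀ c ∈ List.range' 2 9, Low47 a b c 2 → ∀ d ∈ List.range' 2 9,
    Low47 a b c d → Remains47 a b c d := by
  decide +kernel

theorem isCharges_S47 (a b c d : ℕ) (p q r s : ℚ) : S47.IsCharges ![a, b, c, d] ![p, q, r, s] ↔
    a * p + q = 1 ∧ b * q + r = 1 ∧ c * r + p = 1 ∧ d * s + p = 1 := by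
  simp [Skeleton.IsCharges, Skeleton.targetCharge, S47, Fin.forall_fin_succ]

theorem realized_family47 (k : ℕ) : Realized S47 (family47 k) := by
  intro _
  simp only [family47]
  rw [isCharges_S47, centralCharge_vec4_lt]
  have hk1 : (0 : ℚ) < 12 * k + 5 := by positivity
  have hk0 : (12 * k + 5 : ℚ) ≠ 0 := hk1.ne'
  refine ⟨⟨?_, ?_, ?_, ?_⟩, ?_⟩
  · rw [← mul_div_assoc, ← add_div, div_eq_one_iff_eq hk0]; push_cast; ring
  · rw [← mul_div_assoc, ← add_div, div_eq_one_iff_eq hk0]; push_cast; ring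
  · rw [← mul_div_assoc, ← add_div, div_eq_one_iff_eq hk0]; push_cast; ring
  · rw [← mul_div_assoc, ← add_div, div_eq_one_iff_eq hk0]; push_cast; ring
  · rw [← add_div, ← add_div, ← add_div, lt_div_iff₀ hk1]
    linarith

theorem family47_mem (k : ℕ) (hk : 1 ≤ k) : (family47 k).1 ∈ S47.irreducibleExponents := by
  simp only [family47]
  rw [mem_S47]
  norm_num
  -- The link is `3x + (3k + 1)y = 12k + 5`, solved by `y = 2`.
  refine ⟨by omega, ⟨2 * k + 1, 2, by ring⟩, ?_, ?_, ?_, ?_, by omega⟩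
  · exact Nat.not_dvd_of_lt_of_lt_mul_succ (k := 3) (by omega) (by omega)
  · exact Nat.not_dvd_of_lt_of_lt_mul_succ (k := 2) (by omega) (by omega)
  · omega
  · exact Nat.not_dvd_of_lt_of_lt_mul_succ (k := 4) (by omega) (by omega)

theorem S47_irreducibleExponents : S47.irreducibleExponents =
    {m | ∃ k, 1 ≤ k ∧ m = (family47 k).1} ∪ {![3, 2, 2, 5]} := by
  ext m
  constructor
  · intro hm
    rw [eq_vec4 m] at hm ⊢
    rw [mem_S47] at hm
    generalize m 0 = a at hm ⊢
    generalize m 1 = b at hm ⊢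
    generalize m 2 = c at hm ⊢
    generalize m 3 = d at hm ⊢
    obtain ⟨ha, hb, hc, hd, ⟨x, y, hxy⟩, h0, h1, h2, h3, hlt⟩ := hm
    have hcd : c ≠ d := by
      rintro rfl
      exact h2 ⟨x + y, by rw [← hxy]; ring⟩
    have hlow : Low47 a b c d := by
      obtain ⟨u, rfl⟩ := Nat.exists_eq_add_of_le' (show 1 ≤ a by omega)
      obtain ⟨v, rfl⟩ := Nat.exists_eq_add_of_le' (show 1 ≤ b by omega)
      obtain ⟨w, rfl⟩ := Nat.exists_eq_add_of_le' (show 1 ≤ c by omega)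
      simp only [Nat.add_sub_cancel] at hlt
      unfold Low47
      linarith
    have hr := downClosed_low47.truncate (F := Remains47) 10 (by norm_num) remains47
      ha hb hc hd hlow
    have e : ∀ x, min x 10 < 10 → min x 10 = x := by omega
    have hD : a * b * c + 1 = c * ((a - 1) * b + 1) + ((b - 1) * c + 1) := by
      obtain ⟨u, rfl⟩ := Nat.exists_eq_add_of_le' (show 1 ≤ a by omega)
      obtain ⟨v, rfl⟩ := Nat.exists_eq_add_of_le' (show 1 ≤ b by omega)
      simp only [Nat.add_sub_cancel]
      ring
    have hle : (min a 10 - 1) * b + 1 ≤ (a - 1) * b + 1 := by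
      have : min a 10 - 1 ≤ a - 1 := by omega
      gcongr
    have hN0 : ¬ (b - 1) * c + 1 ∣ a * b * c + 1 := fun h => h0 (Nat.mul_dvd_mul_right h d)
    have hN1 : ¬ (c - 1) * a + 1 ∣ a * b * c + 1 := fun h => h1 (Nat.mul_dvd_mul_right h d)
    have hN2 : ¬ (a - 1) * b + 1 ∣ a * b * c + 1 := fun h => h2 (Nat.mul_dvd_mul_right h d)
    have l1 : (a - 1) * b + 1 ∣ d * ((b - 1) * c + 1) := by
      have h : ((a - 1) * b + 1) * (d * c) + d * ((b - 1) * c + 1) =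
          ((a - 1) * b + 1) * (x * d + y * c) := by
        rw [hD] at hxy
        linarith
      exact (Nat.dvd_add_right (Dvd.intro _ rfl)).1 (h ▸ Dvd.intro _ rfl)
    have hnc : ¬ Nat.Coprime ((a - 1) * b + 1) d := by
      intro h
      refine hN2 ?_
      rw [hD]
      exact (Dvd.intro_left _ rfl).add (h.dvd_of_dvd_mul_left l1)
    -- A consequence of the link that no longer involves `c`, needed where `c` is unbounded.
    have hgcd : Nat.gcd (d * (b - 1)) ((a - 1) * b + 1) ∣ d := by
      have h := (Nat.gcd_dvd_right (d * (b - 1)) ((a - 1) * b + 1)).trans l1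
      rw [show d * ((b - 1) * c + 1) = d * (b - 1) * c + d by ring] at h
      exact (Nat.dvd_add_right ((Nat.gcd_dvd_left _ _).mul_right c)).1 h
    rcases hr with ⟨hc', h⟩ | ⟨ha', hb', hd'⟩ | ⟨hb', hd'⟩ | ⟨ha', hb', hd', h⟩ |
      ⟨ha', hb', hc', h⟩ | ⟨hb', hc', hd', h⟩ | ⟨ha', hb', hc', hd'⟩ |
      ⟨ha', hb', hc', hd'⟩ | ⟨ha', hb', hc', hd'⟩
    · omega
    · obtain rfl : a = 2 := by omega
      obtain rfl : b = 2 := by omega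
      obtain rfl : d = 3 := by omega
      left
      have hxy' : 3 * x + c * y = 4 * c + 1 := by
        norm_num at hxy
        linarith
      have hy : y ≤ 4 := by
        by_contra! h
        have : c * 5 ≤ c * y := Nat.mul_le_mul_left c h
        omega
      -- Modulo `3` the link equation excludes `y = 1` and `y = 4`, while `y = 0` and `y = 3` give
      -- `c ≡ 2`, where the third charge is the inverse of an integer.
      have hc1 : c % 3 = 1 := by
        norm_num at h2 h3
        interval_cases y
        · exfalso
          omega
        · exfalso
          omega
        · omega
        · exfalso
          omega
        · exfalso
          omega
      obtain ⟨k, rfl⟩ : ∃ k, c = 3 * k + 1 := ⟨c / 3, by omega⟩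
      exact ⟨k, by omega, rfl⟩
    · obtain rfl : b = 2 := by omega
      obtain rfl : d = 2 := by omega
      exact absurd (by simp) hnc
    · rw [e _ ha', e _ hb', e _ hd'] at h
      tauto
    · rw [e _ ha', e _ hb', e _ hc'] at h
      tauto
    · rw [e _ hb', e _ hc', e _ hd'] at h
      rcases h with h | ⟨ha', h⟩
      · exact absurd (Nat.le_of_dvd (Nat.mul_pos (by omega) (by omega)) l1) (by omega)
      · rw [e _ ha'] at h
        exact absurd l1 h
    -- The next two tuples have the unsolvable link equations `6x + 3y = 26` and `4x + 2y = 13`.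
    · obtain rfl : a = 2 := by omega
      obtain rfl : b = 2 := by omega
      obtain rfl : c = 3 := by omega
      obtain rfl : d = 6 := by omega
      omega
    · obtain rfl : a = 2 := by omega
      obtain rfl : b = 3 := by omega
      obtain rfl : c = 2 := by omega
      obtain rfl : d = 4 := by omega
      omega
    · obtain rfl : a = 3 := by omega
      obtain rfl : b = 2 := by omega
      obtain rfl : c = 2 := by omega
      obtain rfl : d = 5 := by omega
      right
      rfl
  · rintro (⟨k, hk, rfl⟩ | rfl)
    · exact family47_mem k hk
    · rw [mem_S47]
      exact ⟨by decide, by decide, by decide, by decide, ⟨1, 4, by decide⟩, by decide, by decide,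
        by decide, by decide, by decide⟩

end LG

theorem mainTheorem2 :
    -- every connected skeleton on four nodes is exactly one of the nine
    (∀ α, (LG.skeletons4 α).Connected) ∧
    (∀ S : LG.Skeleton 4, S.Connected → ∃! α : Fin 9, S.Iso (LG.skeletons4 α)) ∧
    -- five of them carry no irreducible theories
    (LG.S43.irreducibleExponents = ∅ ∧ LG.S44.irreducibleExponents = ∅ ∧
      LG.S46.irreducibleExponents = ∅ ∧ LG.S48.irreducibleExponents = ∅ ∧
      LG.S49.irreducibleExponents = ∅) ∧
    -- the first skeleton: eight infinite families and 108 sporadic exponents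
    ((∀ a k, LG.Realized LG.S41 (LG.family41 a k)) ∧
      (∀ k l, LG.Realized LG.S41 (LG.family41' k l)) ∧
      (∀ a N, ∃ k ≥ N, (LG.family41 a k).1 ∈ LG.S41.irreducibleExponents) ∧
      (∀ N, ∃ k ≥ N, ∃ l ≥ N, (LG.family41' k l).1 ∈ LG.S41.irreducibleExponents) ∧
      LG.sporadic41.Finite ∧ LG.sporadic41.ncard = 108 ∧
      IsGreatest {e | ∃ m ∈ LG.sporadic41, ∃ i, m i = e} 13) ∧
    -- the second skeleton: one infinite family and five sporadic exponents
    ((∀ k l, LG.Realized LG.S42 (LG.family42 k l)) ∧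
      LG.S42.irreducibleExponents =
        {m | ∃ k l, 1 ≤ k ∧ m = (LG.family42 k l).1} ∪
          {![2, 7, 3, 3], ![2, 7, 3, 4], ![3, 7, 2, 2], ![3, 7, 2, 3], ![3, 7, 4, 2]}) ∧
    -- the fifth skeleton: three infinite families and 22 sporadic exponents up to rotation
    ((∀ a k, LG.Realized LG.S45 (LG.family45 a k)) ∧
      (∀ k l, LG.Realized LG.S45 (LG.family45' k l)) ∧
      (∀ a N, ∃ k ≥ N, (LG.family45 a k).1 ∈ LG.S45.irreducibleExponents) ∧
      (∀ N, ∃ k ≥ N, ∃ l ≥ N, (LG.family45' k l).1 ∈ LG.S45.irreducibleExponents) ∧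
      LG.sporadic45.Finite ∧ (LG.cyclicClass '' LG.sporadic45).ncard = 22 ∧
      IsGreatest {e | ∃ m ∈ LG.sporadic45, ∃ i, m i = e} 8) ∧
    -- the seventh skeleton: one infinite family and one sporadic exponent
    ((∀ k, LG.Realized LG.S47 (LG.family47 k)) ∧
      LG.S47.irreducibleExponents =
        {m | ∃ k, 1 ≤ k ∧ m = (LG.family47 k).1} ∪ {![3, 2, 2, 5]}) := by
  refine ⟨LG.connected_skeletons4, LG.existsUnique_iso_skeletons4,
    ⟨LG.S43_irreducibleExponents, LG.S44_irreducibleExponents, LG.S46_irreducibleExponents,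
      LG.S48_irreducibleExponents, LG.S49_irreducibleExponents⟩,
    ⟨LG.realized_family41, LG.realized_family41', LG.exists_family41_mem, LG.exists_family41'_mem,
      LG.sporadic41_finite, LG.ncard_sporadic41, LG.isGreatest_sporadic41⟩,
    ⟨LG.realized_family42, LG.S42_irreducibleExponents⟩,
    ⟨LG.realized_family45, LG.realized_family45', LG.exists_family45_mem, LG.exists_family45'_mem,
      LG.sporadic45_finite, LG.ncard_image_cyclicClass_sporadic45, LG.isGreatest_sporadic45⟩,
    ⟨LG.realized_family47, LG.S47_irreducibleExponents⟩⟩
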